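/- **Setting.** Let $A,G,Q\in\mathbb C^{n\times n}$, $n\ge 1$, with $G,Q$ Hermitian, and consider the continuous-time algebraic Riccati equation $A^*X+XA+Q=XGX$ with Hamiltonian $H=\begin{bmatrix}A&-G\\-Q&-A^*\end{bmatrix}$. For $1\le k\le n$ let $S_k\in\mathbb C^{2n\times 2n}$ be the matrix with $(S_kv)_k=v_{n+k}$, $(S_kv)_{n+k}=-v_k$, and $(S_kv)_j=v_j$ for the other $j$; for $\mathcal I\subseteq\{1,\dots,n\}$ let $P=\prod_{k\in\mathcal I}S_k$. Then $P^{-1}HP=\begin{bmatrix}A_P&-G_P\\-Q_P&-A_P^*\end{bmatrix}$ with $G_P,Q_P$ Hermitian. Let $\tau>\sqrt2$. Consider the following algorithm, carried out in floating-point arithmetic, where boldface quantities are matrices of circular complex intervals, computed with outward rounding. 1. Compute an approximate stabilizing solution $\check X$ of the equation by a floating-point algorithm. 2. Compute $\mathcal I$ such that $P\begin{bmatrix}I_n\\Y\end{bmatrix}=\begin{bmatrix}U_1\\U_2\end{bmatrix}$ with $U_1$ nonsingular, $U_2U_1^{-1}=\check X$ and $|Y_{ij}|\le\tau$ for all $i,j$.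 3. Form $A_P,G_P,Q_P$ by rearranging entries of $H$ and changing signs. 4. Apply an inner verification algorithm to $A_P^*Y+YA_P+Q_P=YG_PY$ to get an interval matrix $\mathbf Y$. It is either the Krawczyk method for the equation transformed by an approximate eigendecomposition $V\Lambda W$ of the closed-loop matrix (with either of two enclosures of the slopes), or the direct fixed-point iteration $\mathbf Z\mapsto \mathbf I_s(-\mathbf Q_V-\mathbf Z(\mathbf A_V+sI_n-\mathbf G_V\mathbf Z))$ for the correction of an approximate solution in the basis $V$ of an approximate Schur form of the closed-loop matrix (here $s$ is a real shift, $\mathbf A_V,\mathbf G_V,\mathbf Q_V$ enclose the transformed coefficients, and $\mathbf I_s$ encloses $(A_V^*-sI_n)^{-1}$). Each step of either method inflates the current interval matrix, evaluates the operator on it, and stops if the result lies in its interior; otherwise the result is the next interval matrix. At most $k_{\max}$ steps are made. If the inner algorithm fails, return failure. 5. Set $\begin{bmatrix}\mathbf U_1\\\mathbf U_2\end{bmatrix}=P\begin{bmatrix}I_n\\\mathbf Y\end{bmatrix}$ (rearrangement and sign changes only), compute an enclosure $\mathbf X$ of the solutions of $\mathbf X\mathbf U_1=\mathbf U_2$,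 and return $\mathbf X$, or failure if this is not possible. The subroutines are standard ones: the QR algorithm with at most $30$ sweeps per eigenvalue for Schur forms and eigendecompositions; the Schur method for $\check X$; an approximate inverse and a row-sum norm bound for the enclosures of inverses and of solutions of linear systems; and, for step 2, a starting basis followed by pivoting on principal minors of order one and two, with at most $\lfloor n\log 2/\log\gamma\rfloor+1$ pivots, where $\gamma>0$ and $\gamma+\gamma^2=\tau^2$. Every real operation $+,-,\times,/,\sqrt{\ }$ and every comparison counts as one floating-point operation; sign changes and data movement are not counted. **Theorem.** The algorithm requires at most $\mathcal O(n^3\log_\tau n+n^3s)$ floating-point operations, where $s$ is the number of steps made by the inner verification algorithm (with $s=1$ if it stops before its first step). Precisely: (a) For every $\tau_0>\sqrt2$ there is a constant $C$, depending on $\tau_0$ only, such that for all $\tau\ge\tau_0$, all floating-point systems, both inner algorithms, all $k_{\max}$, all $n\ge1$ and all $A,G,Q$, the number of operations is at most $C(n^3\log_\tau n+n^3s)$, whether or not the verification succeeds. (b) In exact arithmetic, the subroutine for step 2 returns, for every $\tau>\sqrt2$ and every Hermitian $\check X$, a set $\mathcal I$ with the properties required there. (c) The bound in (a) also holds for any other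 choice of the subroutines, for every $\tau>\sqrt2$, with $C$ depending on $c$ only, provided that step 2 takes at most $c\,(n^3+n^3\log_\tau n)$ operations and each of the other subroutines (approximate stabilizing solution, eigendecomposition, shift and Schur basis, enclosure for a linear system) at most $c\,n^3$ operations on $n\times n$ matrices. -/

import Mathlib

open scoped Matrix

noncomputable section

namespace Riccati

/-! ### Programs with a floating point operation count -/

/-- The outcome of running a program: its result and the number of floating point
operations executed. -/
structure Flop (α : Type) where
  val : α
  flops : ℕ

instance : Monad Flop where
  pure a := ⟨a, 0⟩
  bind x f := ⟨(f x.val).val, x.flops + (f x.val).flops⟩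

/-- A single floating point operation with result `a`. -/
def oneFlop {α : Type} (a : α) : Flop α := ⟨a, 1⟩

/-- Evaluate a program for every index; the operations add up. -/
def tab {n : ℕ} {α : Type} (f : Fin n → Flop α) : Flop (Fin n → α) :=
  ⟨fun i => (f i).val, ∑ i, (f i).flops⟩

/-- Evaluate a program for every entry of an `n × n` matrix; the operations add up. -/
def tab2 {n : ℕ} {α : Type} (f : Fin n → Fin n → Flop α) : Flop (Matrix (Fin n) (Fin n) α) :=
  ⟨fun i j => (f i j).val, ∑ i, ∑ j, (f i j).flops⟩

/-- `for x in l do s ← body s x`. -/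
def forEach {α σ : Type} (l : List α) (body : σ → α → Flop σ) (s : σ) : Flop σ :=
  l.foldlM body s

/-! ### Floating point systems -/

inductive Mode
  | near
  | down
  | up

/-- A floating point system: the set of machine numbers, the three rounding modes (to nearest,
downward, upward), and the positive machine number `realmin`. -/
structure FloatSystem where
  grid : Set ℝ
  zero_mem : (0 : ℝ) ∈ grid
  neg_mem : ∀ x ∈ grid, -x ∈ grid
  round : Mode → ℝ → ℝ
  down_spec : ∀ x, IsGreatest {y | y ∈ grid ∧ y ≤ x} (round Mode.down x)
  up_spec : ∀ x, IsLeast {y | y ∈ grid ∧ x ≤ y} (round Mode.up x)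
  near_mem : ∀ x, round Mode.near x ∈ grid
  near_spec : ∀ x, ∀ y ∈ grid, |x - round Mode.near x| ≤ |x - y|
  realmin : ℝ
  realmin_mem : realmin ∈ grid
  realmin_pos : 0 < realmin

/-- Exact real arithmetic: every real is a machine number and nothing is rounded. -/
def exactSystem : FloatSystem where
  grid := Set.univ
  zero_mem := Set.mem_univ _
  neg_mem := fun _ _ => Set.mem_univ _
  round := fun _ x => x
  down_spec := fun x => ⟨⟨Set.mem_univ _, le_refl x⟩, fun _ hy => hy.2⟩
  up_spec := fun x => ⟨⟨Set.mem_univ _, le_refl x⟩, fun _ hy => hy.2⟩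
  near_mem := fun _ => Set.mem_univ _
  near_spec := fun x y _ => by simp
  realmin := 1
  realmin_mem := Set.mem_univ _
  realmin_pos := one_pos

/-! The elementary operations on machine numbers. Each of `+`, `-`, `*`, `/`, the square root and
a comparison is one operation; sign changes and moving data are not counted. -/

section Elementary

variable (F : FloatSystem)

def fadd (m : Mode) (x y : ℝ) : Flop ℝ := oneFlop (F.round m (x + y))

def fsub (m : Mode) (x y : ℝ) : Flop ℝ := oneFlop (F.round m (x - y))

def fmul (m : Mode) (x y : ℝ) : Flop ℝ := oneFlop (F.round m (x * y))

def fdiv (m : Mode) (x y : ℝ) : Flop ℝ := oneFlop (F.round m (x / y))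

def fsqrt (m : Mode) (x : ℝ) : Flop ℝ := oneFlop (F.round m (Real.sqrt x))

def flt (x y : ℝ) : Flop Bool := oneFlop (decide (x < y))

def fle (x y : ℝ) : Flop Bool := oneFlop (decide (x ≤ y))

def feq (x y : ℝ) : Flop Bool := oneFlop (decide (x = y))

def fmin (x y : ℝ) : Flop ℝ := do
  if ← fle x y then return x else return y

def fmax (x y : ℝ) : Flop ℝ := do
  if ← fle x y then return y else return x

/-! ### Complex arithmetic, rounded to nearest -/

def cadd (z w : ℂ) : Flop ℂ := do
  let a ← fadd F .near z.re w.re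
  let b ← fadd F .near z.im w.im
  return ⟨a, b⟩

def csub (z w : ℂ) : Flop ℂ := cadd F z (-w)

def cmul (z w : ℂ) : Flop ℂ := do
  let ac ← fmul F .near z.re w.re
  let bd ← fmul F .near z.im w.im
  let ad ← fmul F .near z.re w.im
  let bc ← fmul F .near z.im w.re
  let a ← fsub F .near ac bd
  let b ← fadd F .near ad bc
  return ⟨a, b⟩

/-- Multiplication by a real number. -/
def cscale (t : ℝ) (z : ℂ) : Flop ℂ := do
  let a ← fmul F .near t z.re
  let b ← fmul F .near t z.im
  return ⟨a, b⟩

/-- Squared modulus. -/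
def cabs2 (z : ℂ) : Flop ℝ := do
  let a ← fmul F .near z.re z.re
  let b ← fmul F .near z.im z.im
  fadd F .near a b

def cabs (z : ℂ) : Flop ℝ := do
  fsqrt F .near (← cabs2 F z)

def cinv (z : ℂ) : Flop ℂ := do
  let d ← cabs2 F z
  let a ← fdiv F .near z.re d
  let b ← fdiv F .near (-z.im) d
  return ⟨a, b⟩

def cdiv (z w : ℂ) : Flop ℂ := do
  cmul F z (← cinv F w)

def czero (z : ℂ) : Flop Bool := do
  let a ← feq z.re 0
  let b ← feq z.im 0
  return (a && b)

/-- Principal square root. -/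
def csqrt (z : ℂ) : Flop ℂ := do
  let r ← cabs F z
  let t ← fsqrt F .near (← fdiv F .near (← fadd F .near r |z.re|) 2)
  if ← feq t 0 then
    return 0
  else
    let q ← fdiv F .near (← fdiv F .near |z.im| 2) t
    let p ← fle 0 z.re
    let i ← fle 0 z.im
    let x := if p then t else q
    let y := if p then q else t
    return ⟨x, if i then y else -y⟩

def csum {n : ℕ} (f : Fin n → Flop ℂ) : Flop ℂ :=
  forEach (List.finRange n) (fun acc i => do cadd F acc (← f i)) 0

end Elementary

/-! ### Point matrices -/

abbrev Mat (n : ℕ) := Matrix (Fin n) (Fin n) ℂ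

section PointMatrices

variable (F : FloatSystem) {n : ℕ}

def mmul (A B : Mat n) : Flop (Mat n) :=
  tab2 fun i j => csum F fun k => cmul F (A i k) (B k j)

def madd (A B : Mat n) : Flop (Mat n) := tab2 fun i j => cadd F (A i j) (B i j)

def msub (A B : Mat n) : Flop (Mat n) := tab2 fun i j => csub F (A i j) (B i j)

end PointMatrices

/-! ### Circular complex interval arithmetic with outward rounding -/

/-- The closed disc with the given centre and radius. -/
structure Disc where
  mid : ℂ
  rad : ℝ

def Disc.ofPoint (z : ℂ) : Disc := ⟨z, 0⟩

instance : Neg Disc := ⟨fun x => ⟨-x.mid, x.rad⟩⟩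

instance : Star Disc := ⟨fun x => ⟨star x.mid, x.rad⟩⟩

section DiscArithmetic

variable (F : FloatSystem)

/-- An upper bound for `√(x² + y²)`. -/
def hypotUp (x y : ℝ) : Flop ℝ := do
  let a ← fmul F .up x x
  let b ← fmul F .up y y
  fsqrt F .up (← fadd F .up a b)

/-- An upper bound for `|x - y|`. -/
def distUp (x y : ℝ) : Flop ℝ := do
  fmax (← fsub F .up x y) (← fsub F .up y x)

/-- An upper bound for the modulus of a complex number. -/
def absUp (z : ℂ) : Flop ℝ := hypotUp F z.re z.im

/-- An upper bound for the distance of two complex numbers. -/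
def cdistUp (z w : ℂ) : Flop ℝ := do
  hypotUp F (← distUp F z.re w.re) (← distUp F z.im w.im)

/-- A disc containing every disc of radius `r` with its centre in `[l, u] + i [l₁, u₁]`. -/
def boxDisc (l u l₁ u₁ r : ℝ) : Flop Disc := do
  let m ← fadd F .up l (← fdiv F .up (← fsub F .up u l) 2)
  let m₁ ← fadd F .up l₁ (← fdiv F .up (← fsub F .up u₁ l₁) 2)
  let d ← fsub F .up m l
  let d₁ ← fsub F .up m₁ l₁
  let ρ ← fadd F .up (← hypotUp F d d₁) r
  return ⟨⟨m, m₁⟩, ρ⟩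

/-- `⟨m₁, r₁⟩ + ⟨m₂, r₂⟩ = ⟨m₁ + m₂, r₁ + r₂⟩`. -/
def dadd (x y : Disc) : Flop Disc := do
  let l ← fadd F .down x.mid.re y.mid.re
  let u ← fadd F .up x.mid.re y.mid.re
  let l₁ ← fadd F .down x.mid.im y.mid.im
  let u₁ ← fadd F .up x.mid.im y.mid.im
  boxDisc F l u l₁ u₁ (← fadd F .up x.rad y.rad)

def dsub (x y : Disc) : Flop Disc := dadd F x (-y)

/-- `⟨m₁, r₁⟩ * ⟨m₂, r₂⟩ = ⟨m₁ m₂, |m₁| r₂ + |m₂| r₁ + r₁ r₂⟩`. -/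
def dmul (x y : Disc) : Flop Disc := do
  let acl ← fmul F .down x.mid.re y.mid.re
  let acu ← fmul F .up x.mid.re y.mid.re
  let bdl ← fmul F .down x.mid.im y.mid.im
  let bdu ← fmul F .up x.mid.im y.mid.im
  let adl ← fmul F .down x.mid.re y.mid.im
  let adu ← fmul F .up x.mid.re y.mid.im
  let bcl ← fmul F .down x.mid.im y.mid.re
  let bcu ← fmul F .up x.mid.im y.mid.re
  let l ← fsub F .down acl bdu
  let u ← fsub F .up acu bdl
  let l₁ ← fadd F .down adl bcl
  let u₁ ← fadd F .up adu bcu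
  let r₁ ← fmul F .up (← absUp F x.mid) y.rad
  let r₂ ← fmul F .up (← absUp F y.mid) x.rad
  let r₃ ← fmul F .up x.rad y.rad
  let r ← fadd F .up (← fadd F .up r₁ r₂) r₃
  boxDisc F l u l₁ u₁ r

/-- `1 / ⟨m, r⟩ = ⟨conj m / (|m|² - r²), r / (|m|² - r²)⟩`; `none` unless the denominator is
found to be positive. -/
def dinv (x : Disc) : Flop (Option Disc) := do
  let a := x.mid.re
  let b := -x.mid.im
  let sl ← fadd F .down (← fmul F .down a a) (← fmul F .down b b)
  let su ← fadd F .up (← fmul F .up a a) (← fmul F .up b b)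
  let dl ← fsub F .down sl (← fmul F .up x.rad x.rad)
  let du ← fsub F .up su (← fmul F .down x.rad x.rad)
  if ← flt 0 dl then
    let l ← fmin (← fdiv F .down a dl) (← fdiv F .down a du)
    let u ← fmax (← fdiv F .up a dl) (← fdiv F .up a du)
    let l₁ ← fmin (← fdiv F .down b dl) (← fdiv F .down b du)
    let u₁ ← fmax (← fdiv F .up b dl) (← fdiv F .up b du)
    let r ← fdiv F .up x.rad dl
    return some (← boxDisc F l u l₁ u₁ r)
  else
    return none

/-- `x / y = x * (1 / y)`. -/
def ddiv (x y : Disc) : Flop (Option Disc) := do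
  match ← dinv F y with
  | none => return none
  | some z => return some (← dmul F x z)

/-- The interval hull of `0` and a disc. -/
def hullZero (x : Disc) : Flop Disc := do
  let a ← absUp F x.mid
  if ← fle a x.rad then
    return x
  else
    let t ← fdiv F .near (← fadd F .near a x.rad) (← fmul F .near 2 a)
    let c ← cscale F t x.mid
    let r₁ ← absUp F c
    let r₂ ← fadd F .up (← cdistUp F x.mid c) x.rad
    return ⟨c, ← fmax r₁ r₂⟩

/-- `□(0, x * ⟨1, 0.1⟩ + ⟨0, realmin⟩)`. -/
def inflateDisc (x : Disc) : Flop Disc := do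
  let y ← dmul F x ⟨1, F.round .up (1 / 10)⟩
  let z ← dadd F y ⟨0, F.realmin⟩
  hullZero F z

/-- Test for inclusion in the topological interior. -/
def insideDisc (x y : Disc) : Flop Bool := do
  let d ← fadd F .up (← cdistUp F x.mid y.mid) x.rad
  flt d y.rad

/-- An upper bound for the magnitude `max {|z| : z ∈ x}`. -/
def magUp (x : Disc) : Flop ℝ := do
  fadd F .up (← absUp F x.mid) x.rad

end DiscArithmetic

/-! ### Interval matrices -/

abbrev IMat (n : ℕ) := Matrix (Fin n) (Fin n) Disc

section IntervalMatrices

variable (F : FloatSystem) {n : ℕ}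

/-- A point matrix as a degenerate interval matrix. -/
def pt (A : Mat n) : IMat n := A.map Disc.ofPoint

def ineg (A : IMat n) : IMat n := A.map fun x => -x

/-- Conjugate transpose. -/
def ict (A : IMat n) : IMat n := fun i j => star (A j i)

def dsum (f : Fin n → Flop Disc) : Flop Disc :=
  forEach (List.finRange n) (fun acc i => do dadd F acc (← f i)) ⟨0, 0⟩

def imul (A B : IMat n) : Flop (IMat n) :=
  tab2 fun i j => dsum F fun k => dmul F (A i k) (B k j)

def iadd (A B : IMat n) : Flop (IMat n) := tab2 fun i j => dadd F (A i j) (B i j)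

def isub (A B : IMat n) : Flop (IMat n) := tab2 fun i j => dsub F (A i j) (B i j)

/-- Hadamard division of an interval matrix by a point matrix. -/
def ihdiv (A : IMat n) (D : Mat n) : Flop (Option (IMat n)) := do
  let t ← tab2 fun i j => ddiv F (A i j) (Disc.ofPoint (D i j))
  return if h : ∀ i j, (t i j).isSome then some (fun i j => (t i j).get (h i j)) else none

/-- Entrywise `ε`-inflation followed by the hull with `0`. -/
def inflate (Z : IMat n) : Flop (IMat n) := tab2 fun i j => inflateDisc F (Z i j)

/-- Test for entrywise inclusion in the interior. -/
def inside (K Z : IMat n) : Flop Bool := do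
  let t ← tab2 fun i j => insideDisc F (K i j) (Z i j)
  return (List.finRange n).all fun i => (List.finRange n).all fun j => t i j

end IntervalMatrices

/-! ### The routines called by the verification algorithms -/

/-- A choice of the routines that the verification algorithms leave open. They are bare programs:
nothing at all is required of their results. -/
structure Kit where
  /-- `care A G Q`: approximate stabilizing solution of `A* X + X A + Q = X G X`. -/
  care : ∀ {n : ℕ}, Mat n → Mat n → Mat n → Flop (Mat n)
  /-- `eig M = (V, W, v)` with `M ≈ V diag(v) W` and `V W ≈ 1`. -/
  eig : ∀ {n : ℕ}, Mat n → Flop (Mat n × Mat n × (Fin n → ℂ))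
  /-- `shift M = (s, V)`: the shift and the basis used by the fixed-point method. -/
  shift : ∀ {n : ℕ}, Mat n → Flop (ℝ × Mat n)
  /-- `lss M B`: enclosure of the solutions of `M X = B`, or failure. -/
  lss : ∀ {n : ℕ}, IMat n → IMat n → Flop (Option (IMat n))
  /-- `perm X`: the set of indices swapped to get a permuted Riccati basis of the column space
  of `[1; X]`. -/
  perm : ∀ {n : ℕ}, Mat n → Flop (Finset (Fin n))

/-- The cost class of the routines: `O(n³)`, and `O(n³ + n³ log_τ n)` for the search for the
permutation, with constant `c`. -/
structure Kit.Within (R : Kit) (c τ : ℝ) : Prop where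
  care : ∀ (n : ℕ), 0 < n → ∀ A G Q : Mat n, ((R.care A G Q).flops : ℝ) ≤ c * (n : ℝ) ^ 3
  eig : ∀ (n : ℕ), 0 < n → ∀ M : Mat n, ((R.eig M).flops : ℝ) ≤ c * (n : ℝ) ^ 3
  shift : ∀ (n : ℕ), 0 < n → ∀ M : Mat n, ((R.shift M).flops : ℝ) ≤ c * (n : ℝ) ^ 3
  lss : ∀ (n : ℕ), 0 < n → ∀ M B : IMat n, ((R.lss M B).flops : ℝ) ≤ c * (n : ℝ) ^ 3
  perm : ∀ (n : ℕ), 0 < n → ∀ X : Mat n,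
    ((R.perm X).flops : ℝ) ≤ c * ((n : ℝ) ^ 3 + (n : ℝ) ^ 3 * Real.logb τ n)

/-- Outcome of a verification algorithm: the computed interval matrix (`none` is failure) and
the number of steps of the iteration that were executed. -/
structure Outcome (n : ℕ) where
  enclosure : Option (IMat n)
  steps : ℕ

section Verification

variable (F : FloatSystem) (R : Kit) {n : ℕ}

/-- The iteration common to the inner verification algorithms: inflate the candidate, evaluate the
operator, stop if the result lies in the interior of the candidate, else continue with the result
as new candidate. On success the final candidate and the result are returned, together
with the number of steps. -/
def iterate (op : IMat n → Flop (Option (IMat n))) :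
    ℕ → IMat n → Flop (Option (IMat n × IMat n) × ℕ)
  | 0, _ => return (none, 0)
  | k + 1, Z₀ => do
    let Z ← inflate F Z₀
    match ← op Z with
    | none => return (none, 1)
    | some K =>
      if ← inside F K Z then
        return (some (Z, K), 1)
      else
        let r ← iterate op k K
        return (r.1, r.2 + 1)

/-- The Krawczyk operator of the affinely transformed equation. With `tight = true` the
slopes are enclosed by the smaller set that needs a Hermitian point `X` in one factor. -/
def krawczykOp (tight : Bool) (A G X V W Λ D : Mat n) (IV IW L Z : IMat n) :
    Flop (Option (IMat n)) := do
  let M ← imul F (← imul F (pt Wᴴ) Z) IV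
  let C ← isub F (pt A) (← imul F (pt G) (← iadd F (pt X) M))
  let C₀ ← if tight then do isub F (pt A) (← imul F (pt G) (pt X)) else pure C
  let N ← imul F (← imul F (ict IW) (ict C₀)) (pt Wᴴ)
  let O ← imul F (← imul F IV C) (pt V)
  let P ← iadd F (← imul F (← isub F (pt Λᴴ) N) Z) (← imul F Z (← isub F (pt Λ) O))
  match ← ihdiv F P D with
  | none => return none
  | some U => return some (← iadd F L U)

/-- The Krawczyk method applied to the affinely transformed equation. -/
def krawczykVerify (tight : Bool) (kmax : ℕ) (A G Q : Mat n) : Flop (Outcome n) := do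
  let X ← R.care A G Q
  let (V, W, v) ← R.eig (← msub F A (← mmul F G X))
  let D ← tab2 fun i j => cadd F (star (v i)) (v j)
  let some IV ← R.lss (pt V) (pt 1) | return ⟨none, 0⟩
  let some IW ← R.lss (pt W) (pt 1) | return ⟨none, 0⟩
  let zeros ← tab2 fun i j => czero (D i j)
  if (List.finRange n).any (fun i => (List.finRange n).any fun j => zeros i j) then
    return ⟨none, 0⟩
  else
    let T₁ ← iadd F (← imul F (pt Aᴴ) (pt X)) (pt Q)
    let T₂ ← imul F (pt X) (← isub F (pt A) (← imul F (pt G) (pt X)))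
    let res ← iadd F T₁ T₂
    let resHat ← imul F (← imul F (ict IW) res) (pt V)
    match ← ihdiv F (ineg resHat) D with
    | none => return ⟨none, 0⟩
    | some L =>
      let r ← iterate F (krawczykOp F tight A G X V W (Matrix.diagonal v) D IV IW L) kmax L
      match r.1 with
      | none => return ⟨none, r.2⟩
      | some (_, K) =>
        let E ← iadd F (pt X) (← imul F (← imul F (pt Wᴴ) K) IV)
        return ⟨some E, r.2⟩

/-- The direct fixed-point method. -/
def fixedPointVerify (kmax : ℕ) (A G Q : Mat n) : Flop (Outcome n) := do
  let X ← R.care A G Q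
  let At ← msub F A (← mmul F G X)
  let (s, V) ← R.shift At
  let some IV ← R.lss (pt V) (pt 1) | return ⟨none, 0⟩
  let AI ← isub F (pt A) (← imul F (pt G) (pt X))
  let Q₁ ← iadd F (← imul F (pt Aᴴ) (pt X)) (← imul F (pt X) (pt A))
  let QI ← isub F (← iadd F Q₁ (pt Q)) (← imul F (← imul F (pt X) (pt G)) (pt X))
  let AV ← imul F (← imul F IV AI) (pt V)
  let GV ← imul F (← imul F IV (pt G)) (ict IV)
  let QV ← imul F (← imul F (pt Vᴴ) QI) (pt V)
  let sI := pt ((s : ℂ) • (1 : Mat n))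
  let some Is ← R.lss (← isub F (ict AV) sI) (pt 1) | return ⟨none, 0⟩
  let Z₀ ← imul F (ineg Is) QV
  let op : IMat n → Flop (Option (IMat n)) := fun Z => do
    let T ← isub F (← iadd F AV sI) (← imul F GV Z)
    return some (← imul F Is (← isub F (ineg QV) (← imul F Z T)))
  let r ← iterate F op kmax Z₀
  match r.1 with
  | none => return ⟨none, r.2⟩
  | some (Z, _) =>
    let E ← iadd F (pt X) (← imul F (← imul F (ict IV) Z) IV)
    return ⟨some E, r.2⟩

/-- The inner verification algorithm. -/
inductive Inner
  | krawczyk (tight : Bool)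
  | fixedPoint

def innerVerify (inner : Inner) (kmax : ℕ) (A G Q : Mat n) : Flop (Outcome n) :=
  match inner with
  | .krawczyk tight => krawczykVerify F R tight kmax A G Q
  | .fixedPoint => fixedPointVerify F R kmax A G Q

end Verification

/-! ### Permuted Riccati bases -/

section Permutation

variable {n : ℕ}

/-- `S k` swaps the entries `k` and `n + k` of a vector and changes the sign of one of them. -/
def swapMatrix (k : Fin n) : Matrix (Fin n ⊕ Fin n) (Fin n ⊕ Fin n) ℂ :=
  Matrix.fromBlocks (1 - Matrix.single k k 1) (Matrix.single k k 1)
    (-Matrix.single k k 1) (1 - Matrix.single k k 1)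

/-- `P`, the product of the matrices `S k` over `k ∈ I`. -/
def permMatrix (I : Finset (Fin n)) : Matrix (Fin n ⊕ Fin n) (Fin n ⊕ Fin n) ℂ :=
  (((List.finRange n).filter (· ∈ I)).map swapMatrix).prod

/-- `P * M`, by rearranging rows and changing signs. -/
def permRows {α κ : Type} [Neg α] (I : Finset (Fin n)) (M : Matrix (Fin n ⊕ Fin n) κ α) :
    Matrix (Fin n ⊕ Fin n) κ α :=
  Matrix.of fun i j => match i with
    | .inl k => if k ∈ I then M (.inr k) j else M (.inl k) j
    | .inr k => if k ∈ I then -M (.inl k) j else M (.inr k) j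

/-- `P⁻¹ * M`, by rearranging rows and changing signs. -/
def permRowsInv {α κ : Type} [Neg α] (I : Finset (Fin n)) (M : Matrix (Fin n ⊕ Fin n) κ α) :
    Matrix (Fin n ⊕ Fin n) κ α :=
  Matrix.of fun i j => match i with
    | .inl k => if k ∈ I then -M (.inr k) j else M (.inl k) j
    | .inr k => if k ∈ I then M (.inl k) j else M (.inr k) j

/-- The Hamiltonian. -/
def hamiltonian (A G Q : Mat n) : Matrix (Fin n ⊕ Fin n) (Fin n ⊕ Fin n) ℂ :=
  Matrix.fromBlocks A (-G) (-Q) (-Aᴴ)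

/-- `P⁻¹ H P`, by rearranging entries and changing signs (`P` is orthogonal). -/
def permHamiltonian (I : Finset (Fin n)) (A G Q : Mat n) :
    Matrix (Fin n ⊕ Fin n) (Fin n ⊕ Fin n) ℂ :=
  (permRowsInv I (permRowsInv I (hamiltonian A G Q))ᵀ)ᵀ

/-- `P` is a permuted Riccati basis for `[1; X]` with all entries bounded by `τ`:
`P [1; Y] = [U₁; U₂]` with `U₁` nonsingular, `U₂ U₁⁻¹ = X` and `|Y i j| ≤ τ`. -/
def IsBoundedBasis (τ : ℝ) (X : Mat n) (I : Finset (Fin n)) : Prop :=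
  ∃ Y U₁ U₂ : Mat n,
    permMatrix I * Matrix.fromRows (1 : Mat n) Y = Matrix.fromRows U₁ U₂ ∧
    IsUnit U₁ ∧ U₂ * U₁⁻¹ = X ∧ ∀ i j, ‖Y i j‖ ≤ τ

/-- Verification through a permuted Riccati basis: permute the equation, verify the permuted
equation with the inner algorithm, and map the enclosure back. The recorded number of steps is
that of the inner algorithm. -/
def permutedVerify (F : FloatSystem) (R : Kit) (inner : Inner) (kmax : ℕ) (A G Q : Mat n) :
    Flop (Outcome n) := do
  let X ← R.care A G Q
  let I ← R.perm X
  let H := permHamiltonian I A G Q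
  let r ← innerVerify F R inner kmax H.toBlocks₁₁ (-H.toBlocks₁₂) (-H.toBlocks₂₁)
  match r.enclosure with
  | none => return ⟨none, r.steps⟩
  | some Y =>
    let U := permRows I (Matrix.fromRows (pt (1 : Mat n)) Y)
    match ← R.lss U.toRows₁ᵀ U.toRows₂ᵀ with
    | none => return ⟨none, r.steps⟩
    | some E => return ⟨some Eᵀ, r.steps⟩

end Permutation

/-! ### Standard routines: dense floating point linear algebra -/

section Standard

variable (F : FloatSystem) {m n : ℕ}

/-- Entry with natural number indices. -/
def entry (M : Mat m) (i j : ℕ) : ℂ :=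
  if h : i < m ∧ j < m then M ⟨i, h.1⟩ ⟨j, h.2⟩ else 0

/-- Approximate inverse by Gauss-Jordan elimination with partial pivoting. -/
def gaussInverse (M : Mat m) : Flop (Mat m) := do
  let r ← forEach (List.finRange m) (fun (S : Mat m × Mat m) k => do
    let best ← forEach (List.finRange m) (fun (b : Fin m × ℝ) i => do
      if i < k then return b
      else
        let a ← cabs F (S.1 i k)
        if ← flt b.2 a then return (i, a) else return b) (k, 0)
    let σ := Equiv.swap k best.1
    let B := S.1.submatrix σ id
    let C := S.2.submatrix σ id
    let d ← cinv F (B k k)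
    let p ← tab fun j => cmul F d (B k j)
    let q ← tab fun j => cmul F d (C k j)
    let B₁ ← tab2 fun i j =>
      if i = k then return p j else do csub F (B i j) (← cmul F (B i k) (p j))
    let C₁ ← tab2 fun i j =>
      if i = k then return q j else do csub F (C i j) (← cmul F (B i k) (q j))
    return (B₁, C₁)) (M, 1)
  return r.2

/-- Verified solution of `M X = B`: with an approximate inverse `T` of the midpoint of `M` and
`X₀ = T * mid B`, if `‖1 - T M‖ ≤ a < 1` in the row sum norm, then column `j` of `X` differs from
that of `X₀` by at most `‖(T (B - M X₀))_j‖ / (1 - a)` in the maximum norm. -/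
def verifyLss (M B : IMat m) : Flop (Option (IMat m)) := do
  let T ← gaussInverse F (M.map Disc.mid)
  let X₀ ← mmul F T (B.map Disc.mid)
  let C ← isub F (pt 1) (← imul F (pt T) M)
  let a ← forEach (List.finRange m) (fun (b : ℝ) i => do
    let t ← forEach (List.finRange m) (fun (acc : ℝ) j => do
      fadd F .up acc (← magUp F (C i j))) 0
    fmax b t) 0
  if ← flt a 1 then
    let den ← fsub F .down 1 a
    if ← flt 0 den then
      let E ← imul F (pt T) (← isub F B (← imul F M (pt X₀)))
      let ρ ← tab fun j => do
        let t ← forEach (List.finRange m) (fun (b : ℝ) i => do fmax b (← magUp F (E i j))) 0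
        fdiv F .up t den
      return some (fun i j => ⟨X₀ i j, ρ j⟩)
    else
      return none
  else
    return none

/-- Similarity by the plane rotation in the plane `(p, q)` that maps `(a, b)` to a multiple of
`(1, 0)`, applied to the first matrix and accumulated in the second one. -/
def rotate (S : Mat m × Mat m) (p q : ℕ) (a b : ℂ) : Flop (Mat m × Mat m) := do
  let r ← fsqrt F .near (← fadd F .near (← cabs2 F a) (← cabs2 F b))
  if ← feq r 0 then
    return S
  else
    let c ← tab fun k : Fin 2 => do
      let z := if k = 0 then a else b
      let x ← fdiv F .near z.re r
      let y ← fdiv F .near z.im r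
      return (⟨x, y⟩ : ℂ)
    let comb : ℂ → ℂ → ℂ → ℂ → Flop ℂ := fun x u y v => do
      cadd F (← cmul F x u) (← cmul F y v)
    let T₁ ← tab2 fun i j : Fin m =>
      if i.val = p then comb (star (c 0)) (entry S.1 p j) (star (c 1)) (entry S.1 q j)
      else if i.val = q then comb (-c 1) (entry S.1 p j) (c 0) (entry S.1 q j)
      else return S.1 i j
    let cols : Mat m → Flop (Mat m) := fun M => tab2 fun i j : Fin m =>
      if j.val = p then comb (c 0) (entry M i p) (c 1) (entry M i q)
      else if j.val = q then comb (-star (c 1)) (entry M i p) (star (c 0)) (entry M i q)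
      else return M i j
    let T₂ ← cols T₁
    let Q₂ ← cols S.2
    return (T₂, Q₂)

/-- Reduction to upper Hessenberg form. -/
def hessenberg (S : Mat m × Mat m) : Flop (Mat m × Mat m) :=
  forEach (List.range m) (fun S k =>
    forEach (List.range m).reverse (fun (S : Mat m × Mat m) i =>
      if k + 2 ≤ i then rotate F S (k + 1) i (entry S.1 (k + 1) k) (entry S.1 i k)
      else return S) S) S

/-- Set negligible subdiagonal entries to zero. -/
def deflate (T : Mat m) : Flop (Mat m) :=
  tab2 fun i j => do
    if i.val = j.val + 1 then
      let d ← fadd F .near (← cabs F (T i i)) (← cabs F (T j j))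
      let e ← fadd F .near d (← cabs F (T i j))
      if ← feq e d then return 0 else return T i j
    else
      return T i j

/-- The lowest unreduced diagonal block of a Hessenberg matrix, as `(first, last)` index. -/
def activeWindow (T : Mat m) : Flop (Option (ℕ × ℕ)) := do
  let r ← forEach (List.range (m - 1)).reverse (fun (w : Option (ℕ × ℕ) × Bool) h => do
    if w.2 then return w
    else
      let z ← czero (entry T (h + 1) h)
      match w.1 with
      | none => if z then return (none, false) else return (some (h, h + 1), false)
      | some (_, hi) => if z then return (w.1, true) else return (some (h, hi), false))
    (none, false)
  return r.1

/-- The eigenvalue of the trailing `2 × 2` block ending at index `h` that is closer to its last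
entry. -/
def wilkinsonShift (T : Mat m) (h : ℕ) : Flop ℂ := do
  let d := entry T h h
  let δ ← cscale F (1 / 2) (← csub F (entry T (h - 1) (h - 1)) d)
  let bc ← cmul F (entry T (h - 1) h) (entry T h (h - 1))
  let w ← csqrt F (← cadd F (← cmul F δ δ) bc)
  let x ← cadd F δ w
  let y ← csub F δ w
  if ← flt (← cabs F x) (← cabs F y) then cadd F d x else cadd F d y

/-- One implicitly shifted QR sweep on the diagonal block `lo, …, hi`. -/
def qrSweep (S : Mat m × Mat m) (lo hi : ℕ) : Flop (Mat m × Mat m) := do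
  let μ ← wilkinsonShift F S.1 hi
  forEach (List.range m) (fun (S : Mat m × Mat m) k => do
    if lo ≤ k ∧ k < hi then
      if k = lo then
        rotate F S k (k + 1) (← csub F (entry S.1 k k) μ) (entry S.1 (k + 1) k)
      else
        rotate F S k (k + 1) (entry S.1 k (k - 1)) (entry S.1 (k + 1) (k - 1))
    else
      return S) S

/-- Schur form `M ≈ Q T Q*` by the QR algorithm, with at most `30` sweeps per eigenvalue;
returns `(T, Q)`. -/
def schur (M : Mat m) : Flop (Mat m × Mat m) := do
  let S ← hessenberg F (M, 1)
  forEach (List.range (30 * m)) (fun (S : Mat m × Mat m) _ => do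
    let T ← deflate F S.1
    match ← activeWindow T with
    | none => return (T, S.2)
    | some (lo, hi) => qrSweep F (T, S.2) lo hi) S

/-- Reorder a Schur form so that eigenvalues with negative real part come first. -/
def reorder (S : Mat m × Mat m) : Flop (Mat m × Mat m) :=
  forEach (List.range m) (fun S _ =>
    forEach (List.range (m - 1)) (fun (S : Mat m × Mat m) k => do
      let a ← flt (entry S.1 k k).re 0
      let b ← flt (entry S.1 (k + 1) (k + 1)).re 0
      if !a && b then
        let d ← csub F (entry S.1 (k + 1) (k + 1)) (entry S.1 k k)
        rotate F S k (k + 1) (entry S.1 k (k + 1)) d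
      else
        return S) S) S

/-- Approximate stabilizing solution by the Schur method: a basis `[U₁; U₂]` of the stable
invariant subspace of the Hamiltonian gives `X = U₂ U₁⁻¹`, which is then symmetrized. -/
def schurCare (A G Q : Mat n) : Flop (Mat n) := do
  let H : Mat (n + n) := Matrix.reindex finSumFinEquiv finSumFinEquiv (hamiltonian A G Q)
  let S ← reorder F (← schur F H)
  let U₁ : Mat n := fun i j => S.2 (Fin.castAdd n i) (Fin.castAdd n j)
  let U₂ : Mat n := fun i j => S.2 (Fin.natAdd n i) (Fin.castAdd n j)
  let X ← mmul F U₂ (← gaussInverse F U₁)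
  tab2 fun i j => do cscale F (1 / 2) (← cadd F (X i j) (star (X j i)))

/-- Eigenvector of an upper triangular matrix for its `k`-th diagonal entry, of norm one, by
back substitution. -/
def triangularVector (T : Mat m) (k : Fin m) : Flop (Fin m → ℂ) := do
  let v ← forEach (List.finRange m).reverse (fun (v : Fin m → ℂ) j => do
    if j < k then
      let acc ← csum F fun l => if j < l then cmul F (T j l) (v l) else return 0
      let d ← csub F (T j j) (T k k)
      let d₁ := if ← czero d then (F.realmin : ℂ) else d
      let x ← cdiv F (-acc) d₁
      return Function.update v j x
    else
      return v) (fun j => if j = k then 1 else 0)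
  let s ← forEach (List.finRange m) (fun (acc : ℝ) j => do fadd F .near acc (← cabs2 F (v j))) 0
  let t ← fdiv F .near 1 (← fsqrt F .near s)
  tab fun j => cscale F t (v j)

/-- Approximate eigendecomposition by the QR algorithm. -/
def qrEig (M : Mat m) : Flop (Mat m × Mat m × (Fin m → ℂ)) := do
  let S ← schur F M
  let Z ← tab fun k => triangularVector F S.1 k
  let V ← mmul F S.2 (Matrix.of fun i j => Z j i)
  let W ← gaussInverse F V
  return (V, W, fun k => S.1 k k)

/-- The shift `-min Re λ` over the eigenvalues, and the unitary Schur factor. -/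
def schurShift (M : Mat m) : Flop (ℝ × Mat m) := do
  let S ← schur F M
  let s ← forEach (List.finRange m) (fun (b : Option ℝ) k => do
    match b with
    | none => return some (S.1 k k).re
    | some x => return some (← fmin x (S.1 k k).re)) none
  return (-(s.getD 0), S.2)

end Standard

/-! ### Standard routines: search for a bounded permuted Riccati basis -/

section Search

variable (F : FloatSystem) {n : ℕ}

/-- From the inverse `N` of a matrix, the inverse of the matrix whose row `k` is replaced
by `r`. -/
def replaceRow (N : Mat n) (k : Fin n) (r : Fin n → ℂ) : Flop (Mat n) := do
  let p ← tab fun j => csum F fun l => cmul F (r l) (N l j)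
  let q ← tab fun j => if j = k then csub F (p j) 1 else return p j
  let u ← tab fun i => cdiv F (N i k) (p k)
  tab2 fun i j => do csub F (N i j) (← cmul F (u i) (q j))

/-- Inverse of `1 - i X` for Hermitian `X`, one row at a time. -/
def inverseCayley (X : Mat n) : Flop (Mat n) :=
  forEach (List.finRange n) (fun N k => do
    let r ← tab fun j => cadd F (if j = k then 1 else 0) ⟨(X k j).im, -(X k j).re⟩
    replaceRow F N k r) 1

/-- Starting basis: row `k` of `1 - i X` is in turn replaced by row `k` of `1` or of `-X`,
whichever gives the determinant of larger modulus. Returns the set of the indices of the second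
kind and the inverse of the resulting matrix. -/
def startBasis (X : Mat n) : Flop (Finset (Fin n) × Mat n) := do
  let N ← inverseCayley F X
  forEach (List.finRange n) (fun (S : Finset (Fin n) × Mat n) k => do
    let b ← csum F fun l => cmul F (-X k l) (S.2 l k)
    let x ← cabs F (S.2 k k)
    let y ← cabs F b
    if ← flt x y then
      return (insert k S.1, ← replaceRow F S.2 k (fun j => -X k j))
    else
      return (S.1, ← replaceRow F S.2 k (fun j => if j = k then 1 else 0))) (∅, N)

/-- The first element of the list at which `f` exceeds `γ`. -/
def firstAbove {α : Type} (γ : ℝ) (f : α → Flop ℝ) : List α → Flop (Option α)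
  | [] => return none
  | a :: l => do
    if ← flt γ (← f a) then return some a else firstAbove γ f l

/-- Principal pivot transform at one index. -/
def pivotOne (Y : Mat n) (k : Fin n) : Flop (Mat n) := do
  let d ← cinv F (Y k k)
  let r ← tab fun j => cmul F d (Y k j)
  tab2 fun i j =>
    if i = k then return (if j = k then -d else -r j)
    else if j = k then do return -(← cmul F (Y i k) d)
    else do csub F (Y i j) (← cmul F (Y i k) (r j))

/-- `Y a a * Y b b - Y a b * Y b a`. -/
def minorTwo (Y : Mat n) (a b : Fin n) : Flop ℂ := do
  csub F (← cmul F (Y a a) (Y b b)) (← cmul F (Y a b) (Y b a))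

/-- Principal pivot transform at two indices. -/
def pivotTwo (Y : Mat n) (a b : Fin n) : Flop (Mat n) := do
  let t ← cinv F (← minorTwo F Y a b)
  let daa ← cmul F t (Y b b)
  let dab ← cmul F t (-Y a b)
  let dba ← cmul F t (-Y b a)
  let dbb ← cmul F t (Y a a)
  let comb : ℂ → ℂ → ℂ → ℂ → Flop ℂ := fun x u y v => do
    cadd F (← cmul F x u) (← cmul F y v)
  let ra ← tab fun j => comb daa (Y a j) dab (Y b j)
  let rb ← tab fun j => comb dba (Y a j) dbb (Y b j)
  tab2 fun i j =>
    if i = a then return (if j = a then -daa else if j = b then -dab else -ra j)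
    else if i = b then return (if j = a then -dba else if j = b then -dbb else -rb j)
    else if j = a then do return -(← comb (Y i a) daa (Y i b) dba)
    else if j = b then do return -(← comb (Y i a) dab (Y i b) dbb)
    else do csub F (Y i j) (← comb (Y i a) (ra j) (Y i b) (rb j))

/-- The positive root of `γ + γ² = τ²`. -/
def pivotThreshold (τ : ℝ) : ℝ := (Real.sqrt (1 + 4 * τ ^ 2) - 1) / 2

/-- The limit for the number of pivots. -/
def maxPivots (τ : ℝ) (n : ℕ) : ℕ :=
  ⌊(n : ℝ) * Real.log 2 / Real.log (pivotThreshold τ)⌋₊ + 1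

/-- Pivot on principal minors of order one or two whose modulus exceeds the threshold, while there
are any (and the limit is not reached). The state is the set of swapped indices, the current `Y`
up to the signs of its rows and columns, and whether the search is over. -/
def searchBasis (τ : ℝ) (X : Mat n) : Flop (Finset (Fin n)) := do
  let γ := pivotThreshold τ
  let S ← startBasis F X
  let B : Mat n := fun i j => if i ∈ S.1 then (if i = j then 1 else 0) else X i j
  let Y₀ ← mmul F B S.2
  let r ← forEach (List.range (maxPivots τ n))
    (fun (W : Finset (Fin n) × Mat n × Bool) _ => do
      if W.2.2 then return W
      else
        let Y := W.2.1
        match ← firstAbove γ (fun k => cabs F (Y k k)) (List.finRange n) with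
        | some k => return (symmDiff W.1 {k}, ← pivotOne F Y k, false)
        | none =>
          let pairs := (List.finRange n ×ˢ List.finRange n).filter fun p => p.1 < p.2
          match ← firstAbove γ (fun p => do cabs F (← minorTwo F Y p.1 p.2)) pairs with
          | some p => return (symmDiff W.1 {p.1, p.2}, ← pivotTwo F Y p.1 p.2, false)
          | none => return (W.1, Y, true))
    (S.1, Y₀, false)
  return r.1

end Search

/-- The standard routines. -/
def standardKit (F : FloatSystem) (τ : ℝ) : Kit where
  care := fun A G Q => schurCare F A G Q
  eig := fun M => qrEig F M
  shift := fun M => schurShift F M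
  lss := fun M B => verifyLss F M B
  perm := fun X => searchBasis F τ X

end Riccati

end

/-! The cost bounds need no numerical analysis. Every loop has a length fixed by the dimensions, a
prescribed limit, or the number of inner steps, and every branch can be charged at its worst. Counts
are therefore bounded uniformly over all intermediate values (`bind_le`, `ite_le`, `forEach_le`),
whatever the rounding. Matrix products, inversions and the verified linear solver are cubic by
inspection. The QR algorithm is cubic because a plane rotation touches two rows and two columns only
(`rotate_le`) and there are at most 30 sweeps per eigenvalue. The only data-dependent quantity left
in the bounds is the number of inner steps; `StepBound` carries it along, and each step costs O(n³).
The basis search costs O(n³) plus O(n²) per pivot, with at most ⌊n log 2 / log γ⌋ + 1 pivots. For τ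
≥ τ₀ > √2 this is O(n³), since γ increases with τ and exceeds 1.

Correctness of the search rests on the potential |det U|, where U and V are the upper and lower
blocks of P⁻¹[1; X] up to common row signs, and Y U = V. Upper bound: the rows of U - iV are
unimodular multiples of those of 1 - iX, so |det(1 - iY)| |det U| = |det(1 - iX)|. As Y is
Hermitian, |det(1 - iY)| = ∏ |1 - iλ| ≥ 1, hence |det U| ≤ |det(1 - iX)|
(`IsSignedBasis.norm_det_le`). Lower bound at the start: row k of 1 - iX is e_k + i(-X_k), so by
linearity of the determinant in that row, one of the two replacements e_k, -X_k keeps at least half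
of the modulus. After n rows at least 2⁻ⁿ |det(1 - iX)| is left (`startBasis_spec`). Growth: a pivot
multiplies |det U| by the modulus of the principal minor used, which exceeds γ
(`det_swapTop_singleton`, `det_swapTop_pair`). So t pivots force γ^t ≤ 2ⁿ, and the search stops by
itself within the limit. Then all principal minors of order one and two are at most γ in modulus,
and |Y_ab|² ≤ |Y_aa Y_bb| + γ ≤ γ² + γ = τ² (`norm_le_of_principal_minors_le`). -/

namespace Riccati

/-! ### Operation counts of composite programs -/

section Flops

variable {α β σ : Type}

@[simp] theorem Flop.val_pure (a : α) : (pure a : Flop α).val = a := rfl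

@[simp] theorem Flop.val_bind (x : Flop α) (f : α → Flop β) :
    (x >>= f).val = (f x.val).val := rfl

theorem Flop.flops_pure (a : α) : (pure a : Flop α).flops = 0 := rfl

theorem Flop.flops_bind (x : Flop α) (f : α → Flop β) :
    (x >>= f).flops = x.flops + (f x.val).flops := rfl

theorem pure_le (a : α) : (pure a : Flop α).flops ≤ 0 := le_refl _

/-- Quantifying over every intermediate value `v`, not just `x.val`, makes the counts independent of
the rounding and of the data. -/
theorem bind_le {x : Flop α} {f : α → Flop β} {a b : ℕ} (hx : x.flops ≤ a)
    (hf : ∀ v, (f v).flops ≤ b) : (x >>= f).flops ≤ a + b :=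
  Nat.add_le_add hx (hf _)

/-- The sum instead of the maximum keeps all bounds polynomial; it costs a constant factor only. -/
theorem ite_le {p : Prop} [Decidable p] {x y : Flop α} {a b : ℕ} (hx : x.flops ≤ a)
    (hy : y.flops ≤ b) : (if p then x else y).flops ≤ a + b := by
  split <;> omega

theorem forEach_le {l : List α} {body : σ → α → Flop σ} {s : σ} {b : ℕ}
    (h : ∀ s x, (body s x).flops ≤ b) : (forEach l body s).flops ≤ l.length * b := by
  induction l generalizing s with
  | nil => exact Nat.zero_le _
  | cons x l ih =>
    have h₁ : (forEach (x :: l) body s).flops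
        = (body s x).flops + (forEach l body (body s x).val).flops := rfl
    rw [h₁, List.length_cons, Nat.succ_mul, Nat.add_comm]
    exact Nat.add_le_add ih (h s x)

theorem forEach_finRange_le {n : ℕ} {body : σ → Fin n → Flop σ} {s : σ} {b : ℕ}
    (h : ∀ s x, (body s x).flops ≤ b) :
    (forEach (List.finRange n) body s).flops ≤ n * b := by
  simpa using forEach_le (l := List.finRange n) (s := s) h

theorem forEach_range_le {n : ℕ} {body : σ → ℕ → Flop σ} {s : σ} {b : ℕ}
    (h : ∀ s x, (body s x).flops ≤ b) : (forEach (List.range n) body s).flops ≤ n * b := by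
  simpa using forEach_le (l := List.range n) (s := s) h

theorem tab_le {n : ℕ} {f : Fin n → Flop α} {b : ℕ} (h : ∀ i, (f i).flops ≤ b) :
    (tab f).flops ≤ n * b := by
  simpa [tab] using Finset.sum_le_card_nsmul Finset.univ (fun i => (f i).flops) b fun i _ => h i

theorem tab2_le {n : ℕ} {f : Fin n → Fin n → Flop α} {b : ℕ} (h : ∀ i j, (f i j).flops ≤ b) :
    (tab2 f).flops ≤ n * (n * b) :=
  tab_le (f := fun i => tab (f i)) fun i => tab_le (h i)

theorem card_val_eq_le_one {n : ℕ} (p : ℕ) :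
    (Finset.univ.filter fun i : Fin n => i.val = p).card ≤ 1 :=
  Finset.card_le_one.2 fun a ha b hb => Fin.ext (by simp_all)

theorem tab_sparse_le {n : ℕ} {f : Fin n → Flop α} {b : ℕ} (p : ℕ)
    (h : ∀ i, (f i).flops ≤ if i.val = p then b else 0) : (tab f).flops ≤ b := by
  calc (tab f).flops ≤ ∑ i : Fin n, if i.val = p then b else 0 := by
        simp only [tab]; exact Finset.sum_le_sum fun i _ => h i
    _ = (Finset.univ.filter fun i : Fin n => i.val = p).card * b := by
      rw [← Finset.sum_filter, Finset.sum_const, smul_eq_mul]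
    _ ≤ 1 * b := Nat.mul_le_mul_right _ (card_val_eq_le_one p)
    _ = b := one_mul b

/-- Needed for plane rotations: charging all n² entries would make the QR algorithm quartic. The two
conditions are added, so p = q needs no separate case. -/
theorem tab2_rows_le {n : ℕ} {f : Fin n → Fin n → Flop α} {b : ℕ} (p q : ℕ)
    (h : ∀ i j, (f i j).flops ≤ (if i.val = p then b else 0) + if i.val = q then b else 0) :
    (tab2 f).flops ≤ n * (2 * b) := by
  have key : ∀ p : ℕ, ∑ i : Fin n, (if i.val = p then b else 0) ≤ b := fun p =>
    tab_sparse_le (α := Unit) (f := fun i : Fin n => ⟨(), if i.val = p then b else 0⟩) p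
      fun _ => le_refl _
  calc (tab2 f).flops
      ≤ ∑ i : Fin n, ∑ _j : Fin n, ((if i.val = p then b else 0) + if i.val = q then b else 0) := by
        simp only [tab2]; exact Finset.sum_le_sum fun i _ => Finset.sum_le_sum fun j _ => h i j
    _ = n * (∑ i : Fin n, (if i.val = p then b else 0)
          + ∑ i : Fin n, if i.val = q then b else 0) := by
        simp [Finset.sum_add_distrib, Finset.mul_sum, mul_add]
    _ ≤ n * (2 * b) := Nat.mul_le_mul_left _ (by have := key p; have := key q; omega)

theorem tab2_cols_le {n : ℕ} {f : Fin n → Fin n → Flop α} {b : ℕ} (p q : ℕ)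
    (h : ∀ i j, (f i j).flops ≤ (if j.val = p then b else 0) + if j.val = q then b else 0) :
    (tab2 f).flops ≤ n * (2 * b) := by
  have : (tab2 f).flops = (tab2 fun i j => f j i).flops := by
    simp only [tab2]; exact Finset.sum_comm
  rw [this]
  exact tab2_rows_le p q fun i j => h j i

theorem le_cube (n : ℕ) : n ≤ n ^ 3 := Nat.le_self_pow (by norm_num) n

theorem sq_le_cube (n : ℕ) : n ^ 2 ≤ n ^ 3 := by
  rcases Nat.eq_zero_or_pos n with rfl | h
  · simp
  · exact Nat.pow_le_pow_right h (by norm_num)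

end Flops

/-! ### Operation counts of scalar and matrix arithmetic -/

section Arithmetic

variable (F : FloatSystem) {n : ℕ}

theorem csum_le {f : Fin n → Flop ℂ} {b : ℕ} (h : ∀ i, (f i).flops ≤ b) :
    (csum F f).flops ≤ n * (b + 2) :=
  forEach_finRange_le fun _ i => bind_le (h i) fun _ => le_refl 2

theorem boxDisc_flops (l u l₁ u₁ r : ℝ) : (boxDisc F l u l₁ u₁ r).flops = 13 := rfl

theorem dadd_flops (x y : Disc) : (dadd F x y).flops = 18 := by
  simp [dadd, Flop.flops_bind, boxDisc_flops, fadd, oneFlop]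

theorem dmul_flops (x y : Disc) : (dmul F x y).flops = 38 := by
  simp [dmul, Flop.flops_bind, boxDisc_flops, fadd, fsub, fmul, oneFlop, absUp, hypotUp, fsqrt]

theorem fmin_flops (x y : ℝ) : (fmin x y).flops = 1 := by
  unfold fmin; rw [Flop.flops_bind]; split <;> rfl

theorem fmax_flops (x y : ℝ) : (fmax x y).flops = 1 := by
  unfold fmax; rw [Flop.flops_bind]; split <;> rfl

theorem hypotUp_flops (x y : ℝ) : (hypotUp F x y).flops = 4 := rfl

theorem distUp_flops (x y : ℝ) : (distUp F x y).flops = 3 := by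
  unfold distUp
  simp only [Flop.flops_bind, fmax_flops]
  rfl

theorem cdistUp_flops (z w : ℂ) : (cdistUp F z w).flops = 10 := by
  unfold cdistUp
  simp only [Flop.flops_bind, distUp_flops, hypotUp_flops]

theorem dinv_le (x : Disc) : (dinv F x).flops ≤ 40 := by
  unfold dinv
  simp only [Flop.flops_bind]
  split
  · simp only [Flop.flops_bind, fmin_flops, fmax_flops]
    simp [fadd, fsub, fmul, fdiv, flt, oneFlop, boxDisc, hypotUp, fsqrt, Flop.flops_bind,
      Flop.flops_pure]
  · simp [fadd, fsub, fmul, flt, oneFlop, Flop.flops_pure]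

theorem ddiv_le (x y : Disc) : (ddiv F x y).flops ≤ 78 := by
  refine bind_le (dinv_le F y) (b := 38) fun v => ?_
  cases v with
  | none => exact Nat.zero_le _
  | some z => exact bind_le (dmul_flops F x z).le fun _ => pure_le _

theorem hullZero_le (x : Disc) : (hullZero F x).flops ≤ 29 := by
  refine bind_le (a := 4) le_rfl (b := 25) fun a => bind_le (a := 1) le_rfl (b := 24) fun c => ?_
  cases c
  · refine bind_le (a := 1) le_rfl (b := 23) fun _ => bind_le (a := 1) le_rfl (b := 22) fun _ =>
      bind_le (a := 1) le_rfl (b := 21) fun _ => bind_le (a := 2) le_rfl (b := 19) fun _ =>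
      bind_le (a := 4) le_rfl (b := 15) fun _ =>
      bind_le (a := 10) (cdistUp_flops F _ _).le (b := 5) fun _ =>
      bind_le (a := 1) le_rfl (b := 4) fun _ =>
      (bind_le (fmax_flops _ _).le fun _ => pure_le _).trans (by norm_num)
  · exact Nat.zero_le _

theorem inflateDisc_le (x : Disc) : (inflateDisc F x).flops ≤ 85 :=
  bind_le (dmul_flops F _ _).le fun _ => bind_le (dadd_flops F _ _).le fun _ => hullZero_le F _

theorem insideDisc_le (x y : Disc) : (insideDisc F x y).flops ≤ 12 := by
  simp [insideDisc, Flop.flops_bind, cdistUp_flops, fadd, flt, oneFlop]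

theorem mmul_le (A B : Mat n) : (mmul F A B).flops ≤ 8 * n ^ 3 :=
  (tab2_le fun _ _ => csum_le F fun _ => le_refl 6).trans (by ring_nf; rfl)

theorem mul_mul_le_cube (b : ℕ) : n * (n * b) ≤ b * n ^ 3 := by
  calc n * (n * b) = b * n ^ 2 := by ring
    _ ≤ b * n ^ 3 := Nat.mul_le_mul_left _ (sq_le_cube n)

theorem tab2_le_cube {α : Type} {f : Fin n → Fin n → Flop α} {b : ℕ}
    (h : ∀ i j, (f i j).flops ≤ b) : (tab2 f).flops ≤ b * n ^ 3 :=
  (tab2_le h).trans (mul_mul_le_cube b)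

theorem msub_le (A B : Mat n) : (msub F A B).flops ≤ 2 * n ^ 3 :=
  tab2_le_cube fun _ _ => le_refl 2

theorem imul_le (A B : IMat n) : (imul F A B).flops ≤ 56 * n ^ 3 :=
  (tab2_le (b := n * 56) fun _ _ => forEach_finRange_le fun _ _ =>
    bind_le (dmul_flops F _ _).le fun _ => (dadd_flops F _ _).le).trans (by ring_nf; rfl)

theorem iadd_le (A B : IMat n) : (iadd F A B).flops ≤ 18 * n ^ 3 :=
  tab2_le_cube fun _ _ => (dadd_flops F _ _).le

theorem isub_le (A B : IMat n) : (isub F A B).flops ≤ 18 * n ^ 3 :=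
  tab2_le_cube fun _ _ => (dadd_flops F _ _).le

theorem ihdiv_le (A : IMat n) (D : Mat n) : (ihdiv F A D).flops ≤ 78 * n ^ 3 :=
  bind_le (tab2_le_cube fun _ _ => ddiv_le F _ _) fun _ => pure_le _

theorem inflate_le (Z : IMat n) : (inflate F Z).flops ≤ 85 * n ^ 3 :=
  tab2_le_cube fun _ _ => inflateDisc_le F _

theorem inside_le (K Z : IMat n) : (inside F K Z).flops ≤ 12 * n ^ 3 :=
  bind_le (tab2_le_cube fun _ _ => insideDisc_le F _ _) fun _ => pure_le _

end Arithmetic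

/-! ### Operation counts of the standard routines -/

section Standard

variable (F : FloatSystem) {m n : ℕ}

theorem gaussInverse_le (M : Mat m) : (gaussInverse F M).flops ≤ 40 * m ^ 3 := by
  have step : (gaussInverse F M).flops
      ≤ m * (m * (0 + (4 + (1 + (0 + 0)))) + (5 + (m * 6 + (m * 6 +
        (m * (m * (0 + (6 + 2))) + (m * (m * (0 + (6 + 2))) + 0)))))) + 0 := by
    refine bind_le (forEach_finRange_le fun S k => ?_) fun _ => pure_le _
    refine bind_le (forEach_finRange_le fun b i => ?_) fun b => ?_
    · refine ite_le (pure_le _) ?_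
      exact bind_le (a := 4) le_rfl fun a => bind_le (a := 1) le_rfl fun c =>
        ite_le (pure_le _) (pure_le _)
    refine bind_le (a := 5) le_rfl fun d => bind_le (tab_le fun j => le_refl 6) fun p =>
      bind_le (tab_le fun j => le_refl 6) fun q => ?_
    exact bind_le (tab2_le fun i j => ite_le (pure_le _)
      (bind_le (a := 6) le_rfl fun _ => le_refl 2))
      fun B => bind_le (tab2_le fun i j => ite_le (pure_le _)
        (bind_le (a := 6) le_rfl fun _ => le_refl 2)) fun C => pure_le _
  have h₁ := le_cube m
  have h₂ := sq_le_cube m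
  nlinarith

theorem magUp_flops (x : Disc) : (magUp F x).flops = 5 := rfl

theorem verifyLss_le (hm : 0 < m) (M B : IMat m) : (verifyLss F M B).flops ≤ 400 * m ^ 3 := by
  have step : (verifyLss F M B).flops
      ≤ 40 * m ^ 3 + (8 * m ^ 3 + (56 * m ^ 3 + (18 * m ^ 3 + (m * (m * (5 + 1) + 1) +
        (1 + (1 + (1 + (56 * m ^ 3 + (18 * m ^ 3 + (56 * m ^ 3 +
          (m * (m * (5 + 1) + 1) + 0))) + 0)) + 0)))))) := by
    refine bind_le (gaussInverse_le F _) fun T => bind_le (mmul_le F _ _) fun X₀ => ?_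
    refine bind_le (imul_le F _ _) fun C' => bind_le (isub_le F _ _) fun C => ?_
    refine bind_le (forEach_finRange_le fun b i => bind_le (forEach_finRange_le fun acc j =>
      bind_le (magUp_flops F _).le fun _ => le_refl 1) fun _ => (fmax_flops _ _).le) fun a => ?_
    refine bind_le (a := 1) le_rfl fun c => ite_le ?_ (pure_le _)
    refine bind_le (a := 1) le_rfl fun den => bind_le (a := 1) le_rfl fun c => ite_le ?_ (pure_le _)
    refine bind_le (imul_le F _ _) fun E' => bind_le (isub_le F _ _) fun E₁ =>
      bind_le (imul_le F _ _) fun E => ?_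
    refine bind_le (tab_le fun j => ?_) fun _ => pure_le _
    exact bind_le (forEach_finRange_le fun b i => bind_le (magUp_flops F _).le fun _ =>
      (fmax_flops _ _).le) fun _ => le_refl 1
  have h₀ : 1 ≤ m ^ 3 := Nat.one_le_pow _ _ hm
  have h₁ := le_cube m
  have h₂ := sq_le_cube m
  nlinarith

theorem rotate_le (S : Mat m × Mat m) (p q : ℕ) (a b : ℂ) :
    (rotate F S p q a b).flops ≤ 13 + 84 * m := by
  have comb : ∀ x u y v : ℂ, (do cadd F (← cmul F x u) (← cmul F y v) : Flop ℂ).flops ≤ 14 :=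
    fun _ _ _ _ => le_refl 14
  have step : (rotate F S p q a b).flops ≤ 3 + (3 + (1 + (1 + (1 + (0 +
      (2 * 2 + (m * (2 * 14) + (m * (2 * 14) + (m * (2 * 14) + 0)))))))))  := by
    refine bind_le (a := 3) le_rfl fun _ => bind_le (a := 3) le_rfl fun _ =>
      bind_le (a := 1) le_rfl fun _ => bind_le (a := 1) le_rfl fun r =>
      bind_le (a := 1) le_rfl fun c => ite_le (pure_le _) ?_
    refine bind_le (tab_le fun k => le_refl 2) fun c => ?_
    refine bind_le (tab2_rows_le p q fun i j => ?_) fun T₁ => ?_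
    · split_ifs <;> first
        | exact comb _ _ _ _
        | exact (comb _ _ _ _).trans (by norm_num)
        | exact Nat.zero_le _
    refine bind_le (tab2_cols_le p q fun i j => ?_) fun T₂ =>
      bind_le (tab2_cols_le p q fun i j => ?_) fun Q₂ => pure_le _
    all_goals
      split_ifs <;> first
        | exact comb _ _ _ _
        | exact (comb _ _ _ _).trans (by norm_num)
        | exact Nat.zero_le _
  omega

theorem hessenberg_le (S : Mat m × Mat m) : (hessenberg F S).flops ≤ 97 * m ^ 3 := by
  have step : (hessenberg F S).flops ≤ m * (m * ((13 + 84 * m) + 0)) := by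
    refine forEach_range_le fun S k => ?_
    simpa using forEach_le (l := (List.range m).reverse) (s := S) fun (S : Mat m × Mat m) i =>
      ite_le (p := k + 2 ≤ i) (rotate_le F S (k + 1) i (entry S.1 (k + 1) k) (entry S.1 i k))
        (pure_le S)
  have h₂ := sq_le_cube m
  nlinarith

theorem deflate_le (T : Mat m) : (deflate F T).flops ≤ 15 * m := by
  have e : (deflate F T).flops ≤ ∑ _j : Fin m, 15 := by
    -- Summed by columns: each column has at most one subdiagonal entry, and only that entry costs
    -- anything.
    have : (deflate F T).flops = ∑ j, (tab fun i => (do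
      if i.val = j.val + 1 then
        let d ← fadd F .near (← cabs F (T i i)) (← cabs F (T j j))
        let e ← fadd F .near d (← cabs F (T i j))
        if ← feq e d then return 0 else return T i j
      else
        return T i j : Flop ℂ)).flops := by
      simp only [deflate, tab2, tab]; exact Finset.sum_comm
    rw [this]
    refine Finset.sum_le_sum fun j _ => tab_sparse_le (j.val + 1) fun i => ?_
    split_ifs
    · exact bind_le (a := 4) le_rfl (b := 11) fun _ => bind_le (a := 4) le_rfl (b := 7) fun _ =>
        bind_le (a := 1) le_rfl (b := 6) fun _ => bind_le (a := 4) le_rfl (b := 2) fun _ =>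
        bind_le (a := 1) le_rfl (b := 1) fun _ => bind_le (a := 1) le_rfl (b := 0) fun _ =>
        ite_le (pure_le _) (pure_le _)
    · exact pure_le _
  simpa [mul_comm] using e

theorem activeWindow_le (T : Mat m) : (activeWindow T).flops ≤ 2 * m := by
  refine (bind_le (a := (m - 1) * 2) (b := 0) ?_ fun _ => pure_le _).trans (by omega)
  refine (forEach_le (b := 2) ?_).trans (by simp)
  · rintro ⟨w, d⟩ h
    cases d
    · refine bind_le (a := 2) le_rfl (b := 0) fun z => ?_
      rcases w with _ | ⟨a, b⟩ <;> cases z <;> exact Nat.zero_le _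
    · exact Nat.zero_le _

theorem csqrt_le (z : ℂ) : (csqrt F z).flops ≤ 12 := by
  refine bind_le (a := 4) le_rfl (b := 8) fun _ => bind_le (a := 1) le_rfl (b := 7) fun _ =>
    bind_le (a := 1) le_rfl (b := 6) fun _ => bind_le (a := 1) le_rfl (b := 5) fun _ =>
    bind_le (a := 1) le_rfl (b := 4) fun c => ?_
  cases c
  · exact le_refl 4
  · exact Nat.zero_le _

theorem wilkinsonShift_le (T : Mat m) (h : ℕ) : (wilkinsonShift F T h).flops ≤ 60 := by
  refine (bind_le (a := 2) le_rfl fun _ => bind_le (a := 2) le_rfl fun _ =>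
    bind_le (a := 6) le_rfl fun _ => bind_le (a := 6) le_rfl fun _ =>
    bind_le (a := 2) le_rfl fun _ => bind_le (csqrt_le F _) fun _ => bind_le (a := 2) le_rfl fun _ =>
    bind_le (a := 2) le_rfl fun _ => bind_le (a := 4) le_rfl fun _ => bind_le (a := 4) le_rfl fun _ =>
    bind_le (a := 1) le_rfl fun _ => ite_le (le_refl 2) (le_refl 2)).trans (by norm_num)

theorem qrSweep_le (S : Mat m × Mat m) (lo hi : ℕ) :
    (qrSweep F S lo hi).flops ≤ 60 + m * (30 + 168 * m) := by
  refine bind_le (wilkinsonShift_le F _ _) fun μ => forEach_range_le fun S k => ?_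
  refine (ite_le (ite_le (bind_le (a := 2) le_rfl fun _ => rotate_le F _ _ _ _ _)
    (rotate_le F _ _ _ _ _)) (pure_le _)).trans (by omega)

/-- The sweep limit, not convergence, gives the bound: 30m sweeps, each made of at most m rotations
of linear cost. -/
theorem schur_le (M : Mat m) : (schur F M).flops ≤ 9000 * m ^ 3 := by
  have step : (schur F M).flops
      ≤ 97 * m ^ 3 + 30 * m * (15 * m + (2 * m + (60 + m * (30 + 168 * m)))) := by
    refine bind_le (hessenberg_le F _) fun S => forEach_range_le fun S k => ?_
    refine bind_le (deflate_le F _) fun T => bind_le (activeWindow_le _) fun w => ?_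
    rcases w with _ | ⟨lo, hi⟩
    · exact Nat.zero_le _
    · exact qrSweep_le F _ _ _
  have h₁ := le_cube m
  have h₂ := sq_le_cube m
  nlinarith

theorem reorder_le (S : Mat m × Mat m) : (reorder F S).flops ≤ 110 * m ^ 3 := by
  have step : (reorder F S).flops ≤ m * ((m - 1) * (1 + (1 + ((2 + (13 + 84 * m)) + 0)))) := by
    refine forEach_range_le fun S _ => forEach_range_le fun S k => ?_
    exact bind_le (a := 1) le_rfl fun _ => bind_le (a := 1) le_rfl fun _ =>
      ite_le (bind_le (a := 2) le_rfl fun _ => rotate_le F _ _ _ _ _) (pure_le _)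
  refine step.trans ((Nat.mul_le_mul_left m (Nat.mul_le_mul_right _ (Nat.sub_le m 1))).trans ?_)
  have h₂ := sq_le_cube m
  nlinarith

/-- The Hamiltonian has order 2n, so the constants of `schur_le` and `reorder_le` are multiplied by
8. -/
theorem schurCare_le (A G Q : Mat n) : (schurCare F A G Q).flops ≤ 80000 * n ^ 3 := by
  have step : (schurCare F A G Q).flops ≤ 9000 * (n + n) ^ 3 + (110 * (n + n) ^ 3 +
      (40 * n ^ 3 + (8 * n ^ 3 + 4 * n ^ 3))) :=
    bind_le (schur_le F _) fun S => bind_le (reorder_le F _) fun _ =>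
      bind_le (gaussInverse_le F _) fun _ => bind_le (mmul_le F _ _) fun _ =>
      tab2_le_cube (b := 4) fun _ _ => le_refl 4
  nlinarith

theorem triangularVector_le (T : Mat m) (k : Fin m) :
    (triangularVector F T k).flops ≤ m * (m * 8 + 20) + 10 * m + 2 := by
  have step : (triangularVector F T k).flops ≤ m * ((m * ((6 + 0) + 2) + (2 + (2 + (11 + 0)))) + 0) +
      (m * (3 + 1) + (1 + (1 + m * 2))) := by
    refine bind_le ?_ fun v => bind_le (forEach_finRange_le fun _ _ =>
      bind_le (a := 3) le_rfl fun _ => le_refl 1) fun s => bind_le (a := 1) le_rfl fun _ =>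
      bind_le (a := 1) le_rfl fun _ => tab_le fun _ => le_refl 2
    refine (forEach_le (b := (m * ((6 + 0) + 2) + (2 + (2 + (11 + 0)))) + 0) fun v j => ?_).trans
      (by simp)
    exact ite_le (bind_le (csum_le F fun l => ite_le (le_refl 6) (pure_le _)) fun acc =>
      bind_le (a := 2) le_rfl fun d => bind_le (a := 2) le_rfl fun c =>
      bind_le (a := 11) le_rfl fun x => pure_le _) (pure_le _)
  nlinarith

theorem qrEig_le (M : Mat m) : (qrEig F M).flops ≤ 9200 * m ^ 3 := by
  have step : (qrEig F M).flops ≤ 9000 * m ^ 3 + (m * (m * (m * 8 + 20) + 10 * m + 2) +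
      (8 * m ^ 3 + (40 * m ^ 3 + 0))) :=
    bind_le (schur_le F _) fun S => bind_le (tab_le fun k => triangularVector_le F _ _) fun Z =>
      bind_le (mmul_le F _ _) fun V => bind_le (gaussInverse_le F _) fun W => pure_le _
  have h₁ := le_cube m
  have h₂ := sq_le_cube m
  nlinarith

theorem schurShift_le (M : Mat m) : (schurShift F M).flops ≤ 9001 * m ^ 3 := by
  have step : (schurShift F M).flops ≤ 9000 * m ^ 3 + (m * 1 + 0) := by
    refine bind_le (schur_le F _) fun S => bind_le (forEach_finRange_le fun b k => ?_)
      fun _ => pure_le _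
    cases b
    · exact Nat.zero_le _
    · exact bind_le (fmin_flops _ _).le fun _ => pure_le _
  have h₁ := le_cube m
  omega

end Standard

/-! ### Operation count of the search for a bounded basis -/

section Search

variable (F : FloatSystem) {n : ℕ}

theorem replaceRow_le (N : Mat n) (k : Fin n) (r : Fin n → ℂ) :
    (replaceRow F N k r).flops ≤ 16 * n ^ 2 + 13 * n := by
  have step : (replaceRow F N k r).flops ≤ n * (n * (6 + 2)) + (n * (2 + 0) + (n * 11 +
      n * (n * (6 + 2)))) :=
    bind_le (tab_le fun j => csum_le F fun l => le_refl 6) fun p =>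
      bind_le (tab_le fun j => ite_le (le_refl 2) (pure_le _)) fun q =>
      bind_le (tab_le fun i => le_refl 11) fun u =>
      tab2_le fun i j => bind_le (a := 6) le_rfl fun _ => le_refl 2
  nlinarith

theorem inverseCayley_le (X : Mat n) : (inverseCayley F X).flops ≤ 31 * n ^ 3 := by
  have step : (inverseCayley F X).flops ≤ n * (n * 2 + (16 * n ^ 2 + 13 * n)) :=
    forEach_finRange_le fun N k => bind_le (tab_le fun j => le_refl 2) fun r =>
      replaceRow_le F _ _ _
  have h₂ := sq_le_cube n
  nlinarith

theorem startBasis_le (X : Mat n) : (startBasis F X).flops ≤ 120 * n ^ 3 := by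
  have step : (startBasis F X).flops ≤ 31 * n ^ 3 + n * (n * (6 + 2) + (4 + (4 + (1 +
      ((16 * n ^ 2 + 13 * n + 0) + (16 * n ^ 2 + 13 * n + 0)))))) := by
    refine bind_le (inverseCayley_le F X) fun N => forEach_finRange_le fun S k => ?_
    exact bind_le (csum_le F fun l => le_refl 6) fun b => bind_le (a := 4) le_rfl fun x =>
      bind_le (a := 4) le_rfl fun y => bind_le (a := 1) le_rfl fun c =>
      ite_le (bind_le (replaceRow_le F _ _ _) fun _ => pure_le _)
        (bind_le (replaceRow_le F _ _ _) fun _ => pure_le _)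
  have h₁ := le_cube n
  have h₂ := sq_le_cube n
  nlinarith

theorem firstAbove_le {α : Type} {γ : ℝ} {f : α → Flop ℝ} {b : ℕ} (h : ∀ a, (f a).flops ≤ b)
    (l : List α) : (firstAbove γ f l).flops ≤ l.length * (b + 1) := by
  induction l with
  | nil => exact Nat.zero_le _
  | cons a l ih =>
    refine (bind_le (h a) fun _ => bind_le (a := 1) le_rfl fun c => ite_le (pure_le _) ih).trans ?_
    rw [List.length_cons]
    exact le_of_eq (by ring)

theorem pivotOne_le (Y : Mat n) (k : Fin n) : (pivotOne F Y k).flops ≤ 25 * n ^ 2 + 6 * n + 5 := by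
  have step : (pivotOne F Y k).flops ≤ 5 + (n * 6 + n * (n * (0 + ((6 + 0) + (6 + 2))))) :=
    bind_le (a := 5) le_rfl fun d => bind_le (tab_le fun _ => le_refl 6) fun r =>
      tab2_le fun i j => ite_le (pure_le _) (ite_le (bind_le (a := 6) le_rfl fun _ => pure_le _)
        (bind_le (a := 6) le_rfl fun _ => le_refl 2))
  nlinarith

theorem minorTwo_flops (Y : Mat n) (a b : Fin n) : (minorTwo F Y a b).flops = 14 := rfl

theorem pivotTwo_le (Y : Mat n) (a b : Fin n) :
    (pivotTwo F Y a b).flops ≤ 50 * n ^ 2 + 28 * n + 43 := by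
  have step : (pivotTwo F Y a b).flops ≤ 14 + (5 + (6 + (6 + (6 + (6 + (n * 14 + (n * 14 +
      n * (n * (0 + (0 + ((14 + 0) + ((14 + 0) + (14 + 2))))))))))))) :=
    bind_le (minorTwo_flops F Y a b).le fun _ => bind_le (a := 5) le_rfl fun t =>
      bind_le (a := 6) le_rfl fun _ => bind_le (a := 6) le_rfl fun _ =>
      bind_le (a := 6) le_rfl fun _ => bind_le (a := 6) le_rfl fun _ =>
      bind_le (tab_le fun _ => le_refl 14) fun _ => bind_le (tab_le fun _ => le_refl 14) fun _ =>
      tab2_le fun i j => ite_le (pure_le _) (ite_le (pure_le _)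
        (ite_le (bind_le (a := 14) le_rfl fun _ => pure_le _)
          (ite_le (bind_le (a := 14) le_rfl fun _ => pure_le _)
            (bind_le (a := 14) le_rfl fun _ => le_refl 2))))
  nlinarith

/-- A round is quadratic: it inspects O(n²) minors at constant cost each, and a pivot is a change of
rank at most two. Positivity of n absorbs the constant terms. -/
theorem searchBasis_le (hn : 0 < n) (τ : ℝ) (X : Mat n) :
    (searchBasis F τ X).flops ≤ 128 * n ^ 3 + maxPivots τ n * (200 * n ^ 2) := by
  have step : (searchBasis F τ X).flops ≤ 120 * n ^ 3 + (8 * n ^ 3 + (maxPivots τ n *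
      (200 * n ^ 2) + 0)) := by
    refine bind_le (startBasis_le F X) fun S => bind_le (mmul_le F _ _) fun Y₀ =>
      bind_le (forEach_range_le fun W _ => ?_) fun _ => pure_le _
    have h₀ : 1 ≤ n ^ 2 := Nat.one_le_pow _ _ hn
    have h₁ : n ≤ n ^ 2 := Nat.le_self_pow (by norm_num) n
    have key : (0 + (n * (4 + 1) + ((25 * n ^ 2 + 6 * n + 5 + 0) + (n * n * ((14 + 4) + 1) +
      (50 * n ^ 2 + 28 * n + 43 + 0))))) ≤ 200 * n ^ 2 := by nlinarith
    refine le_trans ?_ key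
    refine ite_le (pure_le _) ?_
    refine bind_le ((firstAbove_le (b := 4) (fun _ => le_refl 4) _).trans (by simp)) fun o => ?_
    rcases o with _ | k
    · refine le_trans (bind_le ((firstAbove_le (b := 14 + 4)
        (fun p => bind_le (minorTwo_flops F _ _ _).le fun _ => le_refl 4) _).trans
        (Nat.mul_le_mul_right _ ?_)) (b := 50 * n ^ 2 + 28 * n + 43 + 0) fun o => ?_) (Nat.le_add_left _ _)
      · exact (List.length_filter_le _ _).trans (by simp [List.length_product])
      · rcases o with _ | p
        · exact Nat.zero_le _
        · exact bind_le (pivotTwo_le F _ _ _) fun _ => pure_le _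
    · exact le_trans (bind_le (pivotOne_le F _ _) fun _ => pure_le _) (Nat.le_add_right _ _)
  omega

end Search

/-! ### Operation counts of the verification algorithms -/

section Verification

variable {α : Type} {n : ℕ}

/-- The program takes at most `a` operations, and `d` more for each recorded step. -/
def StepBound (x : Flop (Outcome n)) (a d : ℕ) : Prop := x.flops ≤ a + d * x.val.steps

theorem StepBound.pure (o : Outcome n) (d : ℕ) : StepBound (pure o) 0 d := Nat.zero_le _

theorem StepBound.bind {x : Flop α} {f : α → Flop (Outcome n)} {a b d : ℕ} (hx : x.flops ≤ a)
    (hf : ∀ v, StepBound (f v) b d) : StepBound (x >>= f) (a + b) d := by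
  have := hf x.val
  simp only [StepBound, Flop.val_bind, Flop.flops_bind] at this ⊢
  omega

theorem StepBound.mono {x : Flop (Outcome n)} {a b d : ℕ} (h : StepBound x a d) (hab : a ≤ b) :
    StepBound x b d :=
  h.trans (Nat.add_le_add_right hab _)

/-- The routines take at most `K * n ^ 3` operations, except that for the permutation. -/
structure Kit.CubicAt (R : Kit) (K n : ℕ) : Prop where
  care : ∀ A G Q : Mat n, (R.care A G Q).flops ≤ K * n ^ 3
  eig : ∀ M : Mat n, (R.eig M).flops ≤ K * n ^ 3
  shift : ∀ M : Mat n, (R.shift M).flops ≤ K * n ^ 3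
  lss : ∀ M B : IMat n, (R.lss M B).flops ≤ K * n ^ 3

variable (F : FloatSystem)

/-- There is no additive term, because an evaluation that fails is also recorded as a step. The 97
is 85 for the inflation and 12 for the inclusion test. -/
theorem iterate_le {op : IMat n → Flop (Option (IMat n))} {b : ℕ}
    (h : ∀ Z, (op Z).flops ≤ b * n ^ 3) (k : ℕ) (Z : IMat n) :
    (iterate F op k Z).flops ≤ (b + 97) * n ^ 3 * (iterate F op k Z).val.2 := by
  induction k generalizing Z with
  | zero => exact Nat.zero_le _
  | succ k ih =>
    have h₁ := inflate_le F Z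
    have h₂ := h (inflate F Z).val
    rw [iterate]
    simp only [Flop.flops_bind, Flop.val_bind]
    generalize hK : (op (inflate F Z).val).val = o
    rcases o with _ | K
    · simp only [Flop.flops_pure, Flop.val_pure]
      linarith
    · have h₃ := inside_le F K (inflate F Z).val
      have h₄ := ih K
      simp only [Flop.flops_bind, Flop.val_bind]
      split
      · simp only [Flop.flops_pure, Flop.val_pure]
        linarith
      · simp only [Flop.flops_bind, Flop.val_bind, Flop.flops_pure, Flop.val_pure]
        linarith

theorem krawczykOp_le (tight : Bool) (A G X V W Λ D : Mat n) (IV IW L Z : IMat n) :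
    (krawczykOp F tight A G X V W Λ D IV IW L Z).flops ≤ 900 * n ^ 3 := by
  have step : (krawczykOp F tight A G X V W Λ D IV IW L Z).flops ≤
      56 * n ^ 3 + (56 * n ^ 3 + (18 * n ^ 3 + (56 * n ^ 3 + (18 * n ^ 3 + (74 * n ^ 3 +
      (56 * n ^ 3 + (56 * n ^ 3 + (56 * n ^ 3 + (56 * n ^ 3 + (18 * n ^ 3 + (56 * n ^ 3 +
      (18 * n ^ 3 + (56 * n ^ 3 + (18 * n ^ 3 + (78 * n ^ 3 + (18 * n ^ 3 + 0)))))))))))))))) := by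
    refine bind_le (imul_le F _ _) fun _ => bind_le (imul_le F _ _) fun M => ?_
    refine bind_le (iadd_le F _ _) fun _ => bind_le (imul_le F _ _) fun _ =>
      bind_le (isub_le F _ _) fun C => ?_
    -- The continuation `f` occurs in both branches, so `ite_le` would charge it twice. Here 74 = 56
    -- + 18 pays for the extra product and difference.
    have branch : ∀ {f : IMat n → Flop (Option (IMat n))} {b : ℕ},
        (∀ C₀, (f C₀).flops ≤ b) → (if tight then
          imul F (pt G) (pt X) >>= fun T => isub F (pt A) T >>= f else pure C >>= f).flops ≤
          74 * n ^ 3 + b := by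
      intro f b h
      split
      · exact (bind_le (imul_le F _ _) fun _ => bind_le (isub_le F _ _) h).trans (by omega)
      · exact (bind_le (pure_le _) h).trans (by omega)
    refine branch fun C₀ => ?_
    refine bind_le (imul_le F _ _) fun _ => bind_le (imul_le F _ _) fun N => ?_
    refine bind_le (imul_le F _ _) fun _ => bind_le (imul_le F _ _) fun O => ?_
    refine bind_le (isub_le F _ _) fun _ => bind_le (imul_le F _ _) fun _ =>
      bind_le (isub_le F _ _) fun _ => bind_le (imul_le F _ _) fun _ =>
      bind_le (iadd_le F _ _) fun P => bind_le (ihdiv_le F _ _) fun o => ?_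
    rcases o with _ | U
    · exact Nat.zero_le _
    · exact bind_le (iadd_le F _ _) fun _ => pure_le _
  omega

theorem innerVerify_stepBound {R : Kit} {K : ℕ} (hR : R.CubicAt K n) (inner : Inner) (kmax : ℕ)
    (A G Q : Mat n) :
    StepBound (innerVerify F R inner kmax A G Q) ((4 * K + 2000) * n ^ 3) (1000 * n ^ 3) := by
  -- Either method calls four cubic routines. With `K * n ^ 3` and `n ^ 3` as atoms, the bookkeeping
  -- below is linear.
  have e : (4 * K + 2000) * n ^ 3 = 4 * (K * n ^ 3) + 2000 * n ^ 3 := by ring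
  rw [e]
  have noSteps : ∀ {a : ℕ}, StepBound (pure ⟨none, 0⟩ : Flop (Outcome n)) a (1000 * n ^ 3) :=
    fun {a} => Nat.zero_le _
  -- The loop is the only place where steps are charged: 900 + 97 ≤ 1000 per step. What follows it
  -- must report the loop's own step count.
  have loop : ∀ {op : IMat n → Flop (Option (IMat n))} (_ : ∀ Z, (op Z).flops ≤ 900 * n ^ 3)
      (Z : IMat n) {a : ℕ}
      {f : Option (IMat n × IMat n) × ℕ → Flop (Outcome n)}
      (_ : ∀ r, (f r).flops ≤ a ∧ (f r).val.steps = r.2),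
      StepBound (iterate F op kmax Z >>= f) a (1000 * n ^ 3) := by
    intro op hop Z a f hf
    have h₁ := iterate_le F hop kmax Z
    have h₂ := hf (iterate F op kmax Z).val
    simp only [StepBound, Flop.val_bind, Flop.flops_bind, h₂.2]
    have : (900 + 97) * n ^ 3 * (iterate F op kmax Z).val.2
        ≤ 1000 * n ^ 3 * (iterate F op kmax Z).val.2 := by gcongr; norm_num
    omega
  cases inner with
  | krawczyk tight =>
    have step : StepBound (krawczykVerify F R tight kmax A G Q)
        (K * n ^ 3 + (8 * n ^ 3 + (2 * n ^ 3 + (K * n ^ 3 + (2 * n ^ 3 + (K * n ^ 3 +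
          (K * n ^ 3 + (2 * n ^ 3 + (56 * n ^ 3 + (18 * n ^ 3 + (56 * n ^ 3 + (18 * n ^ 3 +
          (56 * n ^ 3 + (18 * n ^ 3 + (56 * n ^ 3 + (56 * n ^ 3 + (78 * n ^ 3 +
          130 * n ^ 3))))))))))))))))) (1000 * n ^ 3) := by
      refine .bind (hR.care _ _ _) fun X => .bind (mmul_le F _ _) fun _ =>
        .bind (msub_le F _ _) fun _ => .bind (hR.eig _) fun VW => ?_
      obtain ⟨V, W, v⟩ := VW
      refine .bind (tab2_le_cube fun _ _ => le_refl 2) fun D => .bind (hR.lss _ _) fun o => ?_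
      rcases o with _ | IV
      · exact noSteps
      refine .bind (hR.lss _ _) fun o => ?_
      rcases o with _ | IW
      · exact noSteps
      refine .bind (tab2_le_cube fun _ _ => le_refl 2) fun zeros => ?_
      split
      · exact noSteps
      refine .bind (imul_le F _ _) fun _ => .bind (iadd_le F _ _) fun T₁ =>
        .bind (imul_le F _ _) fun _ => .bind (isub_le F _ _) fun _ =>
        .bind (imul_le F _ _) fun T₂ => .bind (iadd_le F _ _) fun res =>
        .bind (imul_le F _ _) fun _ => .bind (imul_le F _ _) fun resHat =>
        .bind (ihdiv_le F _ _) fun o => ?_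
      rcases o with _ | L
      · exact noSteps
      refine loop (fun Z => krawczykOp_le F _ _ _ _ _ _ _ _ _ _ _ Z) L fun r => ?_
      rcases r with ⟨_ | ⟨Z, E⟩, s⟩
      · exact ⟨Nat.zero_le _, rfl⟩
      · exact ⟨(bind_le (imul_le F _ _) fun _ => bind_le (imul_le F _ _) fun _ =>
          bind_le (iadd_le F _ _) fun _ => pure_le _).trans (by omega), rfl⟩
    exact step.mono (by omega)
  | fixedPoint =>
    have step : StepBound (fixedPointVerify F R kmax A G Q)
        (K * n ^ 3 + (8 * n ^ 3 + (2 * n ^ 3 + (K * n ^ 3 + (K * n ^ 3 +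
          (56 * n ^ 3 + (18 * n ^ 3 + (56 * n ^ 3 + (56 * n ^ 3 + (18 * n ^ 3 +
          (18 * n ^ 3 + (56 * n ^ 3 + (56 * n ^ 3 + (18 * n ^ 3 + (56 * n ^ 3 + (56 * n ^ 3 +
          (56 * n ^ 3 + (56 * n ^ 3 + (56 * n ^ 3 + (56 * n ^ 3 + (18 * n ^ 3 + (K * n ^ 3 +
          (56 * n ^ 3 + 130 * n ^ 3)))))))))))))))))))))))  (1000 * n ^ 3) := by
      refine .bind (hR.care _ _ _) fun X => .bind (mmul_le F _ _) fun _ =>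
        .bind (msub_le F _ _) fun _ => .bind (hR.shift _) fun sV => ?_
      obtain ⟨s, V⟩ := sV
      refine .bind (hR.lss _ _) fun o => ?_
      rcases o with _ | IV
      · exact noSteps
      refine .bind (imul_le F _ _) fun _ => .bind (isub_le F _ _) fun AI =>
        .bind (imul_le F _ _) fun _ => .bind (imul_le F _ _) fun _ =>
        .bind (iadd_le F _ _) fun Q₁ => .bind (iadd_le F _ _) fun _ =>
        .bind (imul_le F _ _) fun _ => .bind (imul_le F _ _) fun _ =>
        .bind (isub_le F _ _) fun QI =>
        .bind (imul_le F _ _) fun _ => .bind (imul_le F _ _) fun AV =>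
        .bind (imul_le F _ _) fun _ => .bind (imul_le F _ _) fun GV =>
        .bind (imul_le F _ _) fun _ => .bind (imul_le F _ _) fun QV =>
        .bind (isub_le F _ _) fun _ => .bind (hR.lss _ _) fun o => ?_
      rcases o with _ | Is
      · exact noSteps
      refine .bind (imul_le F _ _) fun Z₀ => loop (fun Z => ?_) Z₀ fun r => ?_
      · exact (bind_le (iadd_le F _ _) fun _ => bind_le (imul_le F _ _) fun _ =>
          bind_le (isub_le F _ _) fun T => bind_le (imul_le F _ _) fun _ =>
          bind_le (isub_le F _ _) fun _ => bind_le (imul_le F _ _) fun _ => pure_le _).trans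
          (by omega)
      rcases r with ⟨_ | ⟨Z, E⟩, s⟩
      · exact ⟨Nat.zero_le _, rfl⟩
      · exact ⟨(bind_le (imul_le F _ _) fun _ => bind_le (imul_le F _ _) fun _ =>
          bind_le (iadd_le F _ _) fun _ => pure_le _).trans (by omega), rfl⟩
    exact step.mono (by omega)

/-- Six cubic routine calls: four in the inner method, one for the approximate solution of the
original equation, and one linear system at the end. -/
theorem permutedVerify_stepBound {R : Kit} {K p : ℕ} (hR : R.CubicAt K n)
    (hp : ∀ X : Mat n, (R.perm X).flops ≤ p) (inner : Inner) (kmax : ℕ) (A G Q : Mat n) :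
    StepBound (permutedVerify F R inner kmax A G Q) (p + (6 * K + 2000) * n ^ 3)
      (1000 * n ^ 3) := by
  have step : StepBound (permutedVerify F R inner kmax A G Q)
      (K * n ^ 3 + (p + ((4 * K + 2000) * n ^ 3 + K * n ^ 3))) (1000 * n ^ 3) := by
    refine .bind (hR.care _ _ _) fun X => .bind (hp X) fun I => ?_
    have h₁ := innerVerify_stepBound F hR inner kmax (permHamiltonian I A G Q).toBlocks₁₁
      (-(permHamiltonian I A G Q).toBlocks₁₂) (-(permHamiltonian I A G Q).toBlocks₂₁)
    simp only [StepBound, Flop.val_bind, Flop.flops_bind] at h₁ ⊢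
    generalize innerVerify F R inner kmax _ _ _ = r at h₁ ⊢
    obtain ⟨⟨_ | Y, s⟩, k⟩ := r
    · simp only [Flop.flops_pure, Flop.val_pure] at h₁ ⊢
      omega
    · simp only [Flop.flops_bind, Flop.val_bind] at h₁ ⊢
      have h₂ := hR.lss
        (permRows I (Matrix.fromRows (pt (1 : Mat n)) Y)).toRows₁ᵀ
        (permRows I (Matrix.fromRows (pt (1 : Mat n)) Y)).toRows₂ᵀ
      generalize R.lss _ _ = e at h₂ ⊢
      obtain ⟨_ | E, k'⟩ := e <;> simp only [Flop.flops_pure, Flop.val_pure] at h₁ h₂ ⊢ <;> omega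
  exact step.mono (by linarith)

end Verification

/-! ### The cost of the algorithm -/

section Cost

theorem one_lt_of_sqrt_two_lt {τ : ℝ} (hτ : Real.sqrt 2 < τ) : 1 < τ :=
  lt_trans (by rw [Real.lt_sqrt] <;> norm_num) hτ

theorem two_lt_sq {τ : ℝ} (hτ : Real.sqrt 2 < τ) : 2 < τ ^ 2 :=
  (Real.sqrt_lt' (by linarith [one_lt_of_sqrt_two_lt hτ])).1 hτ

theorem pivotThreshold_spec (τ : ℝ) : pivotThreshold τ + pivotThreshold τ ^ 2 = τ ^ 2 := by
  have h : Real.sqrt (1 + 4 * τ ^ 2) ^ 2 = 1 + 4 * τ ^ 2 := Real.sq_sqrt (by positivity)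
  unfold pivotThreshold
  nlinarith

/-- This is the role of √2: since γ + γ² = τ², the condition τ² > 2 is exactly γ > 1, which makes
pivots enlarge the determinant and log γ positive. -/
theorem one_lt_pivotThreshold {τ : ℝ} (hτ : Real.sqrt 2 < τ) : 1 < pivotThreshold τ := by
  have h₁ := two_lt_sq hτ
  have : 3 < Real.sqrt (1 + 4 * τ ^ 2) := by rw [Real.lt_sqrt] <;> nlinarith
  unfold pivotThreshold
  linarith

theorem pivotThreshold_le_pivotThreshold {τ₀ τ : ℝ} (h₀ : 0 ≤ τ₀) (h : τ₀ ≤ τ) :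
    pivotThreshold τ₀ ≤ pivotThreshold τ := by
  unfold pivotThreshold
  gcongr

theorem logb_natCast_nonneg {τ : ℝ} (hτ : Real.sqrt 2 < τ) {n : ℕ} (hn : 0 < n) :
    0 ≤ Real.logb τ n :=
  Real.logb_nonneg (one_lt_of_sqrt_two_lt hτ) (by exact_mod_cast hn)

theorem permutedVerify_flops_le {c τ : ℝ} {R : Kit} (hτ : Real.sqrt 2 < τ) (hR : R.Within c τ)
    (F : FloatSystem) (inner : Inner) (kmax : ℕ) {n : ℕ} (hn : 0 < n) (A G Q : Mat n) :
    ((permutedVerify F R inner kmax A G Q).flops : ℝ) ≤ (7 * ⌈|c|⌉₊ + 3000) *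
      ((n : ℝ) ^ 3 * Real.logb τ n
        + (n : ℝ) ^ 3 * (max 1 (permutedVerify F R inner kmax A G Q).val.steps : ℕ)) := by
  -- The counts are natural numbers and `c` is an arbitrary real, so it is replaced by a natural
  -- number above it.
  set K := ⌈|c|⌉₊
  have hcK : c ≤ K := (le_abs_self c).trans (Nat.le_ceil _)
  have hL := logb_natCast_nonneg hτ hn
  have cubic : ∀ {k : ℕ}, (k : ℝ) ≤ c * (n : ℝ) ^ 3 → k ≤ K * n ^ 3 := fun {k} h => by
    have : (k : ℝ) ≤ K * (n : ℝ) ^ 3 := h.trans (by gcongr)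
    exact_mod_cast this
  have hC : R.CubicAt K n :=
    ⟨fun A G Q => cubic (hR.care n hn A G Q), fun M => cubic (hR.eig n hn M),
      fun M => cubic (hR.shift n hn M), fun M B => cubic (hR.lss n hn M B)⟩
  have hp : ∀ X : Mat n, (R.perm X).flops ≤
      ⌊(K : ℝ) * ((n : ℝ) ^ 3 + (n : ℝ) ^ 3 * Real.logb τ n)⌋₊ := fun X =>
    Nat.le_floor ((hR.perm n hn X).trans (by gcongr))
  have key := permutedVerify_stepBound F hC hp inner kmax A G Q
  generalize permutedVerify F R inner kmax A G Q = run at key ⊢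
  have hfl : (⌊(K : ℝ) * ((n : ℝ) ^ 3 + (n : ℝ) ^ 3 * Real.logb τ n)⌋₊ : ℝ) ≤
      (K : ℝ) * ((n : ℝ) ^ 3 + (n : ℝ) ^ 3 * Real.logb τ n) := Nat.floor_le (by positivity)
  have key' : (run.flops : ℝ) ≤
      ⌊(K : ℝ) * ((n : ℝ) ^ 3 + (n : ℝ) ^ 3 * Real.logb τ n)⌋₊ + (6 * K + 2000) * (n : ℝ) ^ 3
        + 1000 * (n : ℝ) ^ 3 * run.val.steps := by exact_mod_cast key
  have h₁ : (1 : ℝ) ≤ (max 1 run.val.steps : ℕ) := by exact_mod_cast le_max_left _ _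
  have h₂ : (run.val.steps : ℝ) ≤ (max 1 run.val.steps : ℕ) := by exact_mod_cast le_max_right _ _
  generalize ((max 1 run.val.steps : ℕ) : ℝ) = s at h₁ h₂ ⊢
  have hn3 : (0 : ℝ) ≤ (n : ℝ) ^ 3 := by positivity
  have hNL : 0 ≤ (n : ℝ) ^ 3 * Real.logb τ n := mul_nonneg hn3 hL
  have hK : (0 : ℝ) ≤ K := Nat.cast_nonneg K
  calc (run.flops : ℝ)
      ≤ K * ((n : ℝ) ^ 3 + (n : ℝ) ^ 3 * Real.logb τ n) + (6 * K + 2000) * (n : ℝ) ^ 3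
        + 1000 * (n : ℝ) ^ 3 * run.val.steps := key'.trans (by linarith)
    _ = K * ((n : ℝ) ^ 3 * Real.logb τ n) + (7 * K + 2000) * ((n : ℝ) ^ 3 * 1)
        + 1000 * ((n : ℝ) ^ 3 * run.val.steps) := by ring
    -- The pure n³ term cannot go into the logarithmic one, which vanishes at n = 1; it is absorbed
    -- by n³s because s ≥ 1.
    _ ≤ (7 * K + 3000) * ((n : ℝ) ^ 3 * Real.logb τ n) + (7 * K + 2000) * ((n : ℝ) ^ 3 * s)
        + 1000 * ((n : ℝ) ^ 3 * s) := by gcongr; linarith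
    _ = _ := by ring

/-- The pivot limit is the only part that depends on τ. As τ decreases to √2 its bound blows up,
hence τ₀; for τ ≥ τ₀ monotonicity of γ makes the search O(n³) uniformly, without using the
logarithmic allowance. -/
theorem standardKit_within {τ₀ τ : ℝ} (h₀ : Real.sqrt 2 < τ₀) (h : τ₀ ≤ τ) (F : FloatSystem) :
    (standardKit F τ).Within
      (100000 + 200 * (Real.log 2 / Real.log (pivotThreshold τ₀))) τ := by
  have hγ₀ := one_lt_pivotThreshold h₀
  have hlog₀ := Real.log_pos hγ₀
  have hq : 0 ≤ Real.log 2 / Real.log (pivotThreshold τ₀) := by positivity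
  have cubic : ∀ {k b n : ℕ}, k ≤ b * n ^ 3 → b ≤ 100000 →
      (k : ℝ) ≤ (100000 + 200 * (Real.log 2 / Real.log (pivotThreshold τ₀))) * (n : ℝ) ^ 3 := by
    intro k b n hk hb
    have h₁ : (k : ℝ) ≤ b * (n : ℝ) ^ 3 := by exact_mod_cast hk
    have h₂ : (b : ℝ) ≤ 100000 := by exact_mod_cast hb
    exact h₁.trans (by gcongr; linarith)
  refine ⟨fun n _ A G Q => cubic (schurCare_le F A G Q) (by norm_num),
    fun n _ M => cubic (qrEig_le F M) (by norm_num),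
    fun n _ M => cubic (schurShift_le F M) (by norm_num),
    fun n hn M B => cubic (verifyLss_le F hn M B) (by norm_num), fun n hn X => ?_⟩
  have hL := logb_natCast_nonneg (h₀.trans_le h) hn
  have hpiv : (maxPivots τ n : ℝ) ≤
      n * (Real.log 2 / Real.log (pivotThreshold τ₀)) + 1 := by
    have hle := Real.log_le_log (by linarith)
      (pivotThreshold_le_pivotThreshold (by linarith [one_lt_of_sqrt_two_lt h₀]) h)
    have hfl : (⌊(n : ℝ) * Real.log 2 / Real.log (pivotThreshold τ)⌋₊ : ℝ) ≤
        (n : ℝ) * Real.log 2 / Real.log (pivotThreshold τ) :=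
      Nat.floor_le (div_nonneg (by positivity) (hlog₀.le.trans hle))
    unfold maxPivots
    push_cast
    rw [← mul_div_assoc]
    gcongr
    exact hfl.trans (by gcongr)
  have h₁ : ((searchBasis F τ X).flops : ℝ) ≤
      128 * (n : ℝ) ^ 3 + maxPivots τ n * (200 * (n : ℝ) ^ 2) := by
    exact_mod_cast searchBasis_le F hn τ X
  have hn1 : (n : ℝ) ^ 2 ≤ (n : ℝ) ^ 3 := by exact_mod_cast sq_le_cube n
  have hNL : 0 ≤ (n : ℝ) ^ 3 * Real.logb τ n := by positivity
  generalize Real.log 2 / Real.log (pivotThreshold τ₀) = q at hq hpiv ⊢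
  calc ((searchBasis F τ X).flops : ℝ)
      ≤ 128 * (n : ℝ) ^ 3 + (n * q + 1) * (200 * (n : ℝ) ^ 2) := h₁.trans (by gcongr)
    _ = 128 * (n : ℝ) ^ 3 + 200 * q * (n : ℝ) ^ 3 + 200 * (n : ℝ) ^ 2 := by ring
    _ ≤ 128 * (n : ℝ) ^ 3 + 200 * q * (n : ℝ) ^ 3 + 200 * (n : ℝ) ^ 3 := by gcongr
    _ ≤ (100000 + 200 * q) * (n : ℝ) ^ 3 := by nlinarith [pow_nonneg (Nat.cast_nonneg (α := ℝ) n) 3]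
    _ ≤ (100000 + 200 * q) * ((n : ℝ) ^ 3 + (n : ℝ) ^ 3 * Real.logb τ n) := by
      gcongr; linarith

end Cost

/-! ### Values computed in exact arithmetic -/

section Exact

variable {n : ℕ}

@[simp] theorem val_flt (x y : ℝ) : (flt x y).val = decide (x < y) := rfl

@[simp] theorem val_tab {α : Type} (f : Fin n → Flop α) (i : Fin n) :
    (tab f).val i = (f i).val := rfl

@[simp] theorem val_tab2 {α : Type} (f : Fin n → Fin n → Flop α) (i j : Fin n) :
    (tab2 f).val i j = (f i j).val := rfl

theorem val_ite {α : Type} (p : Prop) [Decidable p] (x y : Flop α) :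
    (if p then x else y).val = if p then x.val else y.val := apply_ite _ _ _ _

theorem val_forEach {α σ : Type} (l : List α) (body : σ → α → Flop σ) (s : σ) :
    (forEach l body s).val = l.foldl (fun s x => (body s x).val) s := by
  induction l generalizing s with
  | nil => rfl
  | cons x l ih => exact ih (body s x).val

@[simp] theorem val_cadd (z w : ℂ) : (cadd exactSystem z w).val = z + w := rfl

@[simp] theorem val_csub (z w : ℂ) : (csub exactSystem z w).val = z - w := by
  rw [sub_eq_add_neg]; rfl

@[simp] theorem val_cmul (z w : ℂ) : (cmul exactSystem z w).val = z * w :=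
  Complex.ext rfl rfl

@[simp] theorem val_cinv (z : ℂ) : (cinv exactSystem z).val = z⁻¹ := by
  apply Complex.ext
  · rw [Complex.inv_re, Complex.normSq_apply]; rfl
  · rw [Complex.inv_im, Complex.normSq_apply]; rfl

@[simp] theorem val_cdiv (z w : ℂ) : (cdiv exactSystem z w).val = z / w := by
  rw [cdiv, Flop.val_bind, val_cmul, val_cinv, div_eq_mul_inv]

@[simp] theorem val_cabs (z : ℂ) : (cabs exactSystem z).val = ‖z‖ := by
  rw [Complex.norm_def, Complex.normSq_apply]; rfl

@[simp] theorem val_csum (f : Fin n → Flop ℂ) :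
    (csum exactSystem f).val = ∑ i, (f i).val := by
  have h : ∀ (l : List (Fin n)) (a : ℂ),
      l.foldl (fun acc i => acc + (f i).val) a = a + (l.map fun i => (f i).val).sum := by
    intro l
    induction l with
    | nil => simp
    | cons x l ih => intro a; rw [List.foldl_cons, ih, List.map_cons, List.sum_cons, add_assoc]
  rw [csum, val_forEach]
  simp only [Flop.val_bind, val_cadd]
  rw [h, zero_add, ← List.ofFn_eq_map, List.sum_ofFn]

@[simp] theorem val_mmul (A B : Mat n) : (mmul exactSystem A B).val = A * B := by
  ext i j
  simp [mmul, Matrix.mul_apply]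

theorem firstAbove_eq_some {α : Type} {γ : ℝ} {f : α → Flop ℝ} {l : List α} {a : α}
    (h : (firstAbove γ f l).val = some a) : a ∈ l ∧ γ < (f a).val := by
  induction l with
  | nil => cases h
  | cons b l ih =>
    simp only [firstAbove, Flop.val_bind, val_flt, decide_eq_true_eq, val_ite, Flop.val_pure] at h
    split at h
    · cases h
      exact ⟨List.mem_cons_self, by assumption⟩
    · exact ⟨List.mem_cons_of_mem _ (ih h).1, (ih h).2⟩

theorem firstAbove_eq_none {α : Type} {γ : ℝ} {f : α → Flop ℝ} {l : List α}
    (h : (firstAbove γ f l).val = none) : ∀ a ∈ l, (f a).val ≤ γ := by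
  induction l with
  | nil => simp
  | cons b l ih =>
    simp only [firstAbove, Flop.val_bind, val_flt, decide_eq_true_eq, val_ite, Flop.val_pure] at h
    split at h
    · cases h
    · rintro a (_ | ⟨_, ha⟩)
      · exact not_lt.1 (by assumption)
      · exact ih h a ha

theorem foldl_induction {α σ : Type} {f : σ → α → σ} {P : ℕ → σ → Prop}
    (h : ∀ k s x, P k s → P (k + 1) (f s x)) (l : List α) :
    ∀ {k m : ℕ} (_ : k + l.length = m) {s : σ}, P k s → P m (l.foldl f s) := by
  induction l with
  | nil =>
    rintro k m rfl s hs
    exact hs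
  | cons x l ih =>
    intro k m hm s hs
    rw [List.length_cons] at hm
    exact ih (k := k + 1) (by omega) (h k s x hs)

/-! ### Replacing a row -/

/-- Multiplying the updated matrix by N = M⁻¹ on the right gives the identity with row k replaced by
rN, whose determinant is its k-th diagonal entry. -/
theorem det_updateRow_eq {M N : Mat n} (hN : N * M = 1) (k : Fin n) (r : Fin n → ℂ) :
    (M.updateRow k r).det = (r ᵥ* N) k * M.det := by
  have h₁ : M.updateRow k r * N = (1 : Mat n).updateRow k (r ᵥ* N) := by
    rw [Matrix.updateRow_mul, mul_eq_one_comm.1 hN]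
  have h₂ : (((1 : Mat n).updateRow k (r ᵥ* N)).det) = (r ᵥ* N) k := by
    rw [← Matrix.cramer_transpose_apply, Matrix.transpose_one, Matrix.cramer_one]
    rfl
  rw [← h₂, ← h₁, Matrix.det_mul, mul_assoc, ← Matrix.det_mul, hN, Matrix.det_one, mul_one]

/-- The Sherman–Morrison formula: replacing a row is a rank-one change of M, hence of its inverse.
-/
theorem replaceRow_mul {M N : Mat n} (hN : N * M = 1) (k : Fin n) (r : Fin n → ℂ)
    (hr : (r ᵥ* N) k ≠ 0) :
    (replaceRow exactSystem N k r).val * M.updateRow k r = 1 := by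
  have hM := mul_eq_one_comm.1 hN
  have hval : (replaceRow exactSystem N k r).val =
      N - Matrix.vecMulVec (fun i => N i k / (r ᵥ* N) k) (r ᵥ* N - Pi.single k 1) := by
    ext i j
    simp only [replaceRow, Flop.val_bind, val_tab, val_tab2, val_csum, val_cmul, val_csub,
      val_cdiv, val_ite, Flop.val_pure, Matrix.sub_apply, Matrix.vecMulVec_apply, Pi.sub_apply,
      Matrix.vecMul, dotProduct, Pi.single_apply]
    split_ifs <;> simp
  -- Column k of N is orthogonal to every old row but the k-th, and the division normalizes its
  -- product with r.
  have hu : M.updateRow k r *ᵥ (fun i => N i k / (r ᵥ* N) k) = Pi.single k 1 := by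
    ext i
    have hMN : ∀ i, ∑ l, M i l * N l k = (1 : Mat n) i k := fun i => by
      rw [← hM, Matrix.mul_apply]
    by_cases hi : i = k
    · subst hi
      simp only [Matrix.mulVec, dotProduct, Matrix.updateRow_self, ← mul_div_assoc,
        ← Finset.sum_div, Pi.single_eq_same]
      exact div_self hr
    · simp only [Matrix.mulVec, dotProduct, Matrix.updateRow_ne hi, ← mul_div_assoc,
        ← Finset.sum_div, hMN, Pi.single_eq_of_ne hi, Matrix.one_apply_ne hi, zero_div]
  rw [mul_eq_one_comm, hval, Matrix.mul_sub, Matrix.mul_vecMulVec, hu, Matrix.updateRow_mul,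
    hM]
  ext i j
  by_cases hi : i = k
  · subst hi
    simp [Matrix.vecMulVec_apply, Matrix.one_apply, Pi.single_apply, eq_comm]
  · simp [Matrix.vecMulVec_apply, hi]

end Exact

/-! ### The starting basis -/

section Start

variable {n : ℕ}

/-- The rows of `1 - i X` with indices in `S`, and those of `1` for the other indices. -/
def partialCayley (X : Mat n) (S : Finset (Fin n)) : Mat n :=
  Matrix.of fun i j => if i ∈ S then (1 - Complex.I • X) i j else (1 : Mat n) i j

theorem partialCayley_univ (X : Mat n) : partialCayley X Finset.univ = 1 - Complex.I • X := by
  ext i j; simp [partialCayley]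

theorem partialCayley_empty (X : Mat n) : partialCayley X ∅ = 1 := by
  ext i j; simp [partialCayley]

theorem updateRow_partialCayley (X : Mat n) (S : Finset (Fin n)) (k : Fin n) :
    (partialCayley X S).updateRow k ((1 - Complex.I • X) k) = partialCayley X (insert k S) := by
  ext i j
  by_cases hi : i = k
  · subst hi; simp [partialCayley]
  · simp [partialCayley, hi]

/-- For v in the kernel, v_i = i(Xv)_i when i ∈ S and v_i = 0 otherwise. In both cases |v_i|² equals
the imaginary unit times conj(v_i)(Xv)_i, so ‖v‖² is the imaginary unit times the real number v*Xv
and must vanish. -/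
theorem det_partialCayley_ne_zero {X : Mat n} (hX : X.IsHermitian) (S : Finset (Fin n)) :
    (partialCayley X S).det ≠ 0 := by
  intro h0
  obtain ⟨v, hv, hmul⟩ := Matrix.exists_mulVec_eq_zero_iff.2 h0
  have hrow : ∀ i, star (v i) * v i = Complex.I * (star (v i) * (X *ᵥ v) i) := by
    intro i
    have hi := congrFun hmul i
    by_cases hiS : i ∈ S
    · have : (partialCayley X S *ᵥ v) i = v i - Complex.I * (X *ᵥ v) i := by
        have : partialCayley X S i = (1 : Mat n) i - Complex.I • X i := by
          ext j; simp [partialCayley, hiS]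
        simp only [Matrix.mulVec, this, sub_dotProduct, smul_dotProduct, smul_eq_mul]
        congr 1
        exact congrFun (Matrix.one_mulVec v) i
      rw [this, Pi.zero_apply, sub_eq_zero] at hi
      linear_combination star (v i) * hi
    · have : (partialCayley X S *ᵥ v) i = v i := by
        have : partialCayley X S i = (1 : Mat n) i := by
          ext j; simp [partialCayley, hiS]
        simp only [Matrix.mulVec, this]
        exact congrFun (Matrix.one_mulVec v) i
      rw [this, Pi.zero_apply] at hi
      simp [hi]
  have hsum : star v ⬝ᵥ v = Complex.I * (star v ⬝ᵥ X *ᵥ v) := by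
    simp only [dotProduct, Pi.star_apply, Finset.mul_sum, hrow]
  have him : (star v ⬝ᵥ X *ᵥ v).im = 0 := hX.im_star_dotProduct_mulVec_self v
  have hre : (star v ⬝ᵥ v).re = 0 := by rw [hsum, Complex.I_mul_re, him, neg_zero]
  have hzero : ∑ i, ‖v i‖ ^ 2 = 0 := by
    rw [← hre]
    simp [dotProduct, Complex.sq_norm, Complex.normSq_apply]
  refine hv (funext fun i => ?_)
  have := (Finset.sum_eq_zero_iff_of_nonneg fun i _ => by positivity).1 hzero i (Finset.mem_univ i)
  simpa using this

/-- The intermediate matrices are the `partialCayley X S`. All of them are nonsingular, so no row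
replacement divides by zero. -/
theorem inverseCayley_mul {X : Mat n} (hX : X.IsHermitian) :
    (inverseCayley exactSystem X).val * (1 - Complex.I • X) = 1 := by
  have hr : ∀ k, (tab fun j => cadd exactSystem (if j = k then 1 else 0)
      ⟨(X k j).im, -(X k j).re⟩ : Flop (Fin n → ℂ)).val = (1 - Complex.I • X) k := by
    intro k
    ext j
    have : (⟨(X k j).im, -(X k j).re⟩ : ℂ) = -(Complex.I * X k j) := by
      apply Complex.ext <;> simp
    simp [this, Matrix.one_apply, eq_comm, sub_eq_add_neg]
  have key : ∀ (l : List (Fin n)) (S : Finset (Fin n)) (N : Mat n), N * partialCayley X S = 1 →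
      l.foldl (fun N k => (replaceRow exactSystem N k ((1 - Complex.I • X) k)).val) N *
        partialCayley X (S ∪ l.toFinset) = 1 := by
    intro l
    induction l with
    | nil => intro S N hN; simpa using hN
    | cons k l ih =>
      intro S N hN
      rw [List.foldl_cons, List.toFinset_cons, Finset.union_insert, ← Finset.insert_union]
      refine ih _ _ ?_
      rw [← updateRow_partialCayley]
      refine replaceRow_mul hN k _ fun h0 => ?_
      have := det_updateRow_eq hN k ((1 - Complex.I • X) k)
      rw [updateRow_partialCayley, h0, zero_mul] at this
      exact det_partialCayley_ne_zero hX _ this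
  have := key (List.finRange n) ∅ 1 (by rw [partialCayley_empty, one_mul])
  rw [inverseCayley, val_forEach]
  simp only [Flop.val_bind, hr]
  convert this using 2
  rw [List.toFinset_finRange, Finset.empty_union, partialCayley_univ]

/-- The upper block of `P⁻¹ [1; X]`. -/
def topRows (X : Mat n) (I : Finset (Fin n)) : Mat n :=
  Matrix.of fun i j => if i ∈ I then -X i j else (1 : Mat n) i j

/-- The lower block of `P⁻¹ [1; X]`. -/
def bottomRows (X : Mat n) (I : Finset (Fin n)) : Mat n :=
  Matrix.of fun i j => if i ∈ I then (1 : Mat n) i j else X i j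

/-- The rows of `topRows X I` with indices in `S`, and those of `1 - i X` for the others. -/
def mixedRows (X : Mat n) (I S : Finset (Fin n)) : Mat n :=
  Matrix.of fun i j => if i ∈ S then topRows X I i j else (1 - Complex.I • X) i j

theorem updateRow_mixedRows_neg (X : Mat n) (I S : Finset (Fin n)) {k : Fin n} :
    (mixedRows X I S).updateRow k (fun j => -X k j) = mixedRows X (insert k I) (insert k S) := by
  ext i j
  by_cases hi : i = k
  · subst hi; simp [mixedRows, topRows]
  · simp [mixedRows, topRows, hi]

theorem updateRow_mixedRows_one (X : Mat n) {I S : Finset (Fin n)} {k : Fin n} (hk : k ∉ I) :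
    (mixedRows X I S).updateRow k (fun j => if j = k then 1 else 0)
      = mixedRows X I (insert k S) := by
  ext i j
  by_cases hi : i = k
  · subst hi; simp [mixedRows, topRows, hk, Matrix.one_apply, eq_comm]
  · simp [mixedRows, topRows, hi]

/-- What is known about the state of the search for a starting basis after the rows in `S`. -/
structure StartInvariant (X : Mat n) (S : Finset (Fin n)) (W : Finset (Fin n) × Mat n) :
    Prop where
  subset : W.1 ⊆ S
  inv : W.2 * mixedRows X W.1 S = 1
  det : ‖(1 - Complex.I • X).det‖ ≤ 2 ^ S.card * ‖(mixedRows X W.1 S).det‖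

theorem StartInvariant.step {X : Mat n} {S : Finset (Fin n)} {W : Finset (Fin n) × Mat n}
    (h : StartInvariant X S W) {k : Fin n} (hk : k ∉ S) :
    StartInvariant X (insert k S) (if ‖W.2 k k‖ < ‖∑ l, -X k l * W.2 l k‖ then
      (insert k W.1, (replaceRow exactSystem W.2 k (fun j => -X k j)).val) else
      (W.1, (replaceRow exactSystem W.2 k (fun j => if j = k then 1 else 0)).val)) := by
  obtain ⟨hsub, hinv, hdet⟩ := h
  have hkI : k ∉ W.1 := fun hk' => hk (hsub hk')
  set M := mixedRows X W.1 S with hM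
  -- Row k is still e_k + i(-X_k). By `det_updateRow_eq` the two numbers are the determinant ratios
  -- of the candidate rows, so the larger has modulus at least 1/2.
  have hsum : W.2 k k + Complex.I * ∑ l, -X k l * W.2 l k = 1 := by
    have h1 : (M * W.2) k k = 1 := by rw [mul_eq_one_comm.1 hinv, Matrix.one_apply_eq]
    rw [Matrix.mul_apply] at h1
    have h2 : ∀ l, M k l * W.2 l k
        = (1 : Mat n) k l * W.2 l k + Complex.I * (-X k l * W.2 l k) := by
      intro l
      simp only [hM, mixedRows, hk, Matrix.of_apply, if_false, Matrix.sub_apply, Matrix.smul_apply,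
        smul_eq_mul]
      ring
    simp only [h2, Finset.sum_add_distrib] at h1
    rw [← h1, Finset.mul_sum]
    congr 1
    simp [Matrix.one_apply]
  have hnorm : 1 ≤ ‖W.2 k k‖ + ‖∑ l, -X k l * W.2 l k‖ := by
    calc (1 : ℝ) = ‖W.2 k k + Complex.I * ∑ l, -X k l * W.2 l k‖ := by rw [hsum, norm_one]
      _ ≤ _ := norm_add_le _ _
      _ = _ := by rw [norm_mul, Complex.norm_I, one_mul]
  -- A ratio of at least 1/2 gives both facts at once: the division is legitimate, and the
  -- determinant loses at most a factor 2.
  have grow : ∀ r : Fin n → ℂ, 1 ≤ 2 * ‖(r ᵥ* W.2) k‖ →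
      (replaceRow exactSystem W.2 k r).val * M.updateRow k r = 1 ∧
        ‖(1 - Complex.I • X).det‖ ≤ 2 ^ (insert k S).card * ‖(M.updateRow k r).det‖ := by
    intro r hr
    refine ⟨replaceRow_mul hinv k r fun h0 => by simp [h0] at hr; linarith, ?_⟩
    rw [det_updateRow_eq hinv, Finset.card_insert_of_notMem hk, norm_mul]
    calc _ ≤ 2 ^ S.card * ‖M.det‖ := hdet
      _ ≤ (2 * ‖(r ᵥ* W.2) k‖) * (2 ^ S.card * ‖M.det‖) := le_mul_of_one_le_left (by positivity) hr
      _ = _ := by ring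
  split_ifs with hlt
  · have := grow (fun j => -X k j) (by
      simp only [Matrix.vecMul, dotProduct]; linarith)
    rw [updateRow_mixedRows_neg] at this
    exact ⟨Finset.insert_subset_insert _ hsub, this.1, this.2⟩
  · have := grow (fun j => if j = k then 1 else 0) (by
      simp only [Matrix.vecMul, dotProduct, ite_mul, one_mul, zero_mul, Finset.sum_ite_eq',
        Finset.mem_univ, if_true]
      linarith)
    rw [updateRow_mixedRows_one X hkI] at this
    exact ⟨hsub.trans (Finset.subset_insert _ _), this.1, this.2⟩

theorem startBasis_spec {X : Mat n} (hX : X.IsHermitian) :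
    (startBasis exactSystem X).val.2 * topRows X (startBasis exactSystem X).val.1 = 1 ∧
    ‖(1 - Complex.I • X).det‖ ≤ 2 ^ n * ‖(topRows X (startBasis exactSystem X).val.1).det‖ := by
  have key : ∀ (l : List (Fin n)) (S : Finset (Fin n)) (W : Finset (Fin n) × Mat n),
      l.Nodup → (∀ k ∈ l, k ∉ S) → StartInvariant X S W →
      StartInvariant X (S ∪ l.toFinset) (l.foldl (fun W k =>
        if ‖W.2 k k‖ < ‖∑ l, -X k l * W.2 l k‖ then
          (insert k W.1, (replaceRow exactSystem W.2 k (fun j => -X k j)).val) else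
          (W.1, (replaceRow exactSystem W.2 k (fun j => if j = k then 1 else 0)).val)) W) := by
    intro l
    induction l with
    | nil => intro S W _ _ h; simpa using h
    | cons k l ih =>
      intro S W hl hS h
      rw [List.foldl_cons, List.toFinset_cons, Finset.union_insert, ← Finset.insert_union]
      obtain ⟨hkl, hl⟩ := List.nodup_cons.1 hl
      refine ih _ _ hl (fun j hj => ?_) (h.step (hS k List.mem_cons_self))
      rw [Finset.mem_insert, not_or]
      exact ⟨fun e => hkl (e ▸ hj), hS j (List.mem_cons_of_mem _ hj)⟩
  have h₀ : mixedRows X ∅ ∅ = 1 - Complex.I • X := by ext i j; simp [mixedRows]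
  have := key (List.finRange n) ∅ (∅, (inverseCayley exactSystem X).val) (List.nodup_finRange n)
    (by simp) ⟨Finset.Subset.refl _, by rw [h₀, inverseCayley_mul hX], by simp [h₀]⟩
  rw [List.toFinset_finRange, Finset.empty_union] at this
  have hval : (startBasis exactSystem X).val = (List.finRange n).foldl (fun W k =>
        if ‖W.2 k k‖ < ‖∑ l, -X k l * W.2 l k‖ then
          (insert k W.1, (replaceRow exactSystem W.2 k (fun j => -X k j)).val) else
          (W.1, (replaceRow exactSystem W.2 k (fun j => if j = k then 1 else 0)).val))
        (∅, (inverseCayley exactSystem X).val) := by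
    rw [startBasis, Flop.val_bind, val_forEach]
    simp only [Flop.val_bind, val_csum, val_cmul, val_cabs, val_flt, decide_eq_true_eq, val_ite,
      Flop.val_pure]
  rw [← hval] at this
  have hu : ∀ I, mixedRows X I Finset.univ = topRows X I := fun I => by ext i j; simp [mixedRows]
  obtain ⟨-, hinv, hdet⟩ := this
  rw [hu] at hinv hdet
  rw [Finset.card_univ, Fintype.card_fin] at hdet
  exact ⟨hinv, hdet⟩

end Start

/-! ### Pivoting -/

section Pivot

variable {n : ℕ}

/-- `U` and `V` are the two blocks of `P⁻¹ [1; X]` up to a common sign for each row. -/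
def IsSignedBasis (X : Mat n) (I : Finset (Fin n)) (U V : Mat n) : Prop :=
  ∀ i, ∃ ε : ℂ, (ε = 1 ∨ ε = -1) ∧ (∀ j, U i j = ε * topRows X I i j) ∧
    ∀ j, V i j = ε * bottomRows X I i j

/-- The rows of `U`, except that those with indices in `K` are replaced by the ones of `-V`. -/
def swapTop (K : Finset (Fin n)) (U V : Mat n) : Mat n :=
  Matrix.of fun i j => if i ∈ K then -V i j else U i j

/-- The rows of `V`, except that those with indices in `K` are replaced by the ones of `U`. -/
def swapBottom (K : Finset (Fin n)) (U V : Mat n) : Mat n :=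
  Matrix.of fun i j => if i ∈ K then U i j else V i j

/-- Swapping an index a second time returns the original pair of rows with opposite sign, since the
square of the swap is -1 on these two coordinates. Hence the row signs in the definition. -/
theorem IsSignedBasis.swap {X : Mat n} {I : Finset (Fin n)} {U V : Mat n}
    (h : IsSignedBasis X I U V) (K : Finset (Fin n)) :
    IsSignedBasis X (symmDiff I K) (swapTop K U V) (swapBottom K U V) := by
  intro i
  obtain ⟨ε, hε, hU, hV⟩ := h i
  by_cases hK : i ∈ K
  · by_cases hI : i ∈ I
    · refine ⟨-ε, by rcases hε with rfl | rfl <;> simp, fun j => ?_, fun j => ?_⟩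
      · simp [swapTop, topRows, Finset.mem_symmDiff, hK, hI, hV, bottomRows]
      · simp [swapBottom, topRows, Finset.mem_symmDiff, hK, hI, hU, bottomRows]
    · refine ⟨ε, hε, fun j => ?_, fun j => ?_⟩
      · simp [swapTop, topRows, Finset.mem_symmDiff, hK, hI, hV, bottomRows]
      · simp [swapBottom, topRows, Finset.mem_symmDiff, hK, hI, hU, bottomRows]
  · refine ⟨ε, hε, fun j => ?_, fun j => ?_⟩
    · simp [swapTop, topRows, Finset.mem_symmDiff, hK, hU]
    · simp [swapBottom, Finset.mem_symmDiff, hK, hV, bottomRows]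

theorem det_swapTop_singleton {Y U V : Mat n} (hY : Y * U = V) (k : Fin n) :
    (swapTop {k} U V).det = -Y k k * U.det := by
  have h₁ : swapTop {k} U V = (1 : Mat n).updateRow k (-Y k) * U := by
    ext i j
    rw [Matrix.updateRow_mul, Matrix.one_mul]
    by_cases hi : i = k
    · subst hi; simp [swapTop, ← hY, Matrix.mul_apply, Matrix.vecMul, dotProduct]
    · simp [swapTop, hi]
  rw [h₁, Matrix.det_mul, ← Matrix.cramer_transpose_apply, Matrix.transpose_one,
    Matrix.cramer_one]
  rfl

/-- The swap multiplies U on the left by 1 + ER, a rank-two change of the identity. Since det(1 +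
ER) = det(1 + RE), the factor is the determinant of a 2 × 2 block of -Y, where the two signs cancel.
-/
theorem det_swapTop_pair {Y U V : Mat n} (hY : Y * U = V) {a b : Fin n} (hab : a ≠ b) :
    (swapTop {a, b} U V).det = (Y a a * Y b b - Y a b * Y b a) * U.det := by
  set E : Matrix (Fin n) (Fin 2) ℂ := Matrix.of fun i t => if i = ![a, b] t then 1 else 0 with hE
  set R : Matrix (Fin 2) (Fin n) ℂ :=
    Matrix.of fun t j => -Y (![a, b] t) j - if ![a, b] t = j then 1 else 0 with hR
  have h₁ : swapTop {a, b} U V = (1 + E * R) * U := by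
    have hER : E * R = Matrix.of fun i j =>
        if i = a ∨ i = b then -Y i j - (1 : Mat n) i j else 0 := by
      ext i j
      rw [Matrix.mul_apply, Fin.sum_univ_two]
      by_cases ha : i = a
      · subst ha
        simp only [hE, hR, Matrix.of_apply, Matrix.cons_val_zero, Matrix.cons_val_one, hab, if_true,
          if_false, one_mul, zero_mul, add_zero, true_or, Matrix.one_apply]
        congr
      · by_cases hb : i = b
        · subst hb; simp [hE, hR, ha, Matrix.one_apply]
        · simp [hE, ha, hb]
    rw [hER]
    ext i j
    simp only [swapTop, ← hY, Matrix.of_apply, Finset.mem_insert, Finset.mem_singleton,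
      Matrix.add_mul, Matrix.one_mul, Matrix.add_apply]
    by_cases hi : i = a ∨ i = b
    · rw [if_pos hi, Matrix.mul_apply, Matrix.mul_apply]
      simp only [Matrix.of_apply, if_pos hi, sub_mul, Finset.sum_sub_distrib, neg_mul,
        Finset.sum_neg_distrib, Matrix.one_apply, ite_mul, one_mul, zero_mul, Finset.sum_ite_eq,
        Finset.mem_univ, if_true]
      ring
    · simp [if_neg hi, Matrix.mul_apply]
  have hRE : ∀ s t, (R * E) s t
      = -Y (![a, b] s) (![a, b] t) - if ![a, b] s = ![a, b] t then 1 else 0 := by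
    intro s t
    simp [Matrix.mul_apply, hR, hE]
  rw [h₁, Matrix.det_mul, Matrix.det_one_add_mul_comm, Matrix.det_fin_two]
  simp only [Matrix.add_apply, hRE]
  simp [hab, hab.symm]

/-- Row k of Y U = V is solved for row k of U, and the result is substituted into the other rows. -/
theorem pivotOne_mul {Y U V : Mat n} (hY : Y * U = V) {k : Fin n} (hk : Y k k ≠ 0) :
    (pivotOne exactSystem Y k).val * swapTop {k} U V = swapBottom {k} U V := by
  ext i c
  have row : ∀ i, Y i k * U k c + ∑ j ∈ Finset.univ.erase k, Y i j * U j c = V i c := fun i => by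
    rw [← hY, Matrix.mul_apply, Finset.add_sum_erase _ (fun j => Y i j * U j c) (Finset.mem_univ k)]
  rw [Matrix.mul_apply, ← Finset.add_sum_erase _ _ (Finset.mem_univ k)]
  have hrow := row k
  have hi := row i
  by_cases hik : i = k
  · subst hik
    have : ∀ j ∈ Finset.univ.erase i, (pivotOne exactSystem Y i).val i j * swapTop {i} U V j c
        = -(Y i i)⁻¹ * (Y i j * U j c) := fun j hj => by
      simp [pivotOne, swapTop, Finset.ne_of_mem_erase hj]
      ring
    rw [Finset.sum_congr rfl this, ← Finset.mul_sum]
    simp only [pivotOne, Flop.val_bind, val_tab2, if_true, Flop.val_pure, val_cinv,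
      swapTop, swapBottom, Matrix.of_apply, Finset.mem_singleton]
    field_simp
    linear_combination -hrow
  · have : ∀ j ∈ Finset.univ.erase k, (pivotOne exactSystem Y k).val i j * swapTop {k} U V j c
        = Y i j * U j c - Y i k * (Y k k)⁻¹ * (Y k j * U j c) := fun j hj => by
      simp [pivotOne, swapTop, Finset.ne_of_mem_erase hj, hik]
      ring
    rw [Finset.sum_congr rfl this, Finset.sum_sub_distrib, ← Finset.mul_sum]
    simp only [pivotOne, Flop.val_bind, val_tab2, if_true, if_neg hik, Flop.val_pure,
      val_cinv, val_cmul, swapTop, swapBottom, Matrix.of_apply, Finset.mem_singleton]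
    field_simp
    linear_combination Y k k * hi - Y i k * hrow

/-- As for one index, with rows a and b of U obtained from a 2 × 2 system by Cramer's rule. The rows
outside {a, b} are common to both sides and stay inside the sums over J. -/
theorem pivotTwo_mul {Y U V : Mat n} (hY : Y * U = V) {a b : Fin n} (hab : a ≠ b)
    (hm : Y a a * Y b b - Y a b * Y b a ≠ 0) :
    (pivotTwo exactSystem Y a b).val * swapTop {a, b} U V = swapBottom {a, b} U V := by
  ext i c
  set J := (Finset.univ.erase a).erase b with hJ
  have split : ∀ f : Fin n → ℂ, ∑ j, f j = f a + (f b + ∑ j ∈ J, f j) := fun f => by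
    rw [Finset.add_sum_erase _ _ (Finset.mem_erase.2 ⟨hab.symm, Finset.mem_univ b⟩),
      Finset.add_sum_erase _ _ (Finset.mem_univ a)]
  have row : ∀ i, Y i a * U a c + (Y i b * U b c + ∑ j ∈ J, Y i j * U j c) = V i c := fun i => by
    rw [← hY, Matrix.mul_apply, split]
  rw [Matrix.mul_apply, split]
  have ha := row a
  have hb := row b
  have hi := row i
  have hne : ∀ j ∈ J, j ≠ a ∧ j ≠ b := fun j hj => by
    simp only [hJ, Finset.mem_erase] at hj; exact ⟨hj.2.1, hj.1⟩
  generalize hδ : Y a a * Y b b - Y a b * Y b a = δ at hm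
  have hval : ∀ i j, (pivotTwo exactSystem Y a b).val i j =
      if i = a then (if j = a then -(δ⁻¹ * Y b b) else if j = b then δ⁻¹ * Y a b
        else -(δ⁻¹ * Y b b * Y a j - δ⁻¹ * Y a b * Y b j))
      else if i = b then (if j = a then δ⁻¹ * Y b a else if j = b then -(δ⁻¹ * Y a a)
        else -(-(δ⁻¹ * Y b a * Y a j) + δ⁻¹ * Y a a * Y b j))
      else if j = a then -(Y i a * (δ⁻¹ * Y b b) - Y i b * (δ⁻¹ * Y b a))
      else if j = b then -(-(Y i a * (δ⁻¹ * Y a b)) + Y i b * (δ⁻¹ * Y a a))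
      else Y i j - (Y i a * (δ⁻¹ * Y b b * Y a j - δ⁻¹ * Y a b * Y b j)
        + Y i b * (-(δ⁻¹ * Y b a * Y a j) + δ⁻¹ * Y a a * Y b j)) := by
    intro i j
    simp only [pivotTwo, minorTwo, Flop.val_bind, val_tab2, val_tab, val_ite, Flop.val_pure,
      val_cinv, val_cmul, val_cadd, val_csub, hδ]
    split_ifs <;> ring
  by_cases hia : i = a
  · subst hia
    have : ∀ j ∈ J, (pivotTwo exactSystem Y i b).val i j * swapTop {i, b} U V j c
        = -(δ⁻¹ * Y b b) * (Y i j * U j c) + δ⁻¹ * Y i b * (Y b j * U j c) := fun j hj => by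
      simp only [hval, swapTop, (hne j hj).1, (hne j hj).2, if_true, if_false, Matrix.of_apply,
        Finset.mem_insert, Finset.mem_singleton, or_self]
      ring
    rw [Finset.sum_congr rfl this, Finset.sum_add_distrib, ← Finset.mul_sum, ← Finset.mul_sum]
    simp only [hval, swapTop, swapBottom, hab, hab.symm, if_true, if_false, Matrix.of_apply,
        Finset.mem_insert, Finset.mem_singleton, or_true, true_or]
    field_simp
    linear_combination Y i b * hb - Y b b * ha + U i c * hδ
  by_cases hib : i = b
  · subst hib
    have : ∀ j ∈ J, (pivotTwo exactSystem Y a i).val i j * swapTop {a, i} U V j c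
        = δ⁻¹ * Y i a * (Y a j * U j c) - δ⁻¹ * Y a a * (Y i j * U j c) := fun j hj => by
      simp only [hval, swapTop, (hne j hj).1, (hne j hj).2, hia, if_true, if_false,
        Matrix.of_apply, Finset.mem_insert, Finset.mem_singleton, or_self]
      ring
    rw [Finset.sum_congr rfl this, Finset.sum_sub_distrib, ← Finset.mul_sum, ← Finset.mul_sum]
    simp only [hval, swapTop, swapBottom, hia, if_true, if_false, Matrix.of_apply,
        Finset.mem_insert, Finset.mem_singleton, or_true, true_or]
    field_simp
    linear_combination Y i a * ha - Y a a * hb + U i c * hδ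
  · have : ∀ j ∈ J, (pivotTwo exactSystem Y a b).val i j * swapTop {a, b} U V j c
        = Y i j * U j c - (Y i a * (δ⁻¹ * Y b b) - Y i b * (δ⁻¹ * Y b a)) * (Y a j * U j c)
          - (-(Y i a * (δ⁻¹ * Y a b)) + Y i b * (δ⁻¹ * Y a a)) * (Y b j * U j c) := fun j hj => by
      simp only [hval, swapTop, (hne j hj).1, (hne j hj).2, hia, hib, if_false,
        Matrix.of_apply, Finset.mem_insert, Finset.mem_singleton, or_self]
      ring
    rw [Finset.sum_congr rfl this, Finset.sum_sub_distrib, Finset.sum_sub_distrib,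
      ← Finset.mul_sum, ← Finset.mul_sum]
    simp only [hval, swapTop, swapBottom, hia, hib, hab, hab.symm, if_true, if_false,
      Matrix.of_apply, Finset.mem_insert, Finset.mem_singleton, or_true, true_or, or_self]
    field_simp
    linear_combination δ * hi - (Y i a * Y b b - Y i b * Y b a) * ha
      - (Y i b * Y a a - Y i a * Y a b) * hb + (Y i a * U a c + Y i b * U b c) * hδ

end Pivot

/-! ### Bounds for signed bases -/

section Bounds

variable {n : ℕ} {X U V Y : Mat n} {I : Finset (Fin n)}

theorem IsSignedBasis.conjTranspose_mul (hX : X.IsHermitian) (h : IsSignedBasis X I U V) :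
    Uᴴ * V = Vᴴ * U := by
  -- Swaps are symplectic: each row's contribution to U*V - V*U depends neither on I nor on the
  -- sign, so it can be computed from [1; X].
  have key : ∀ i j l, star (U i j) * V i l - star (V i j) * U i l
      = (1 : Mat n) i j * X i l - star (X i j) * (1 : Mat n) i l := by
    intro i j l
    obtain ⟨ε, hε, hU, hV⟩ := h i
    have h1 : ∀ j, (starRingEnd ℂ) ((1 : Mat n) i j) = (1 : Mat n) i j := fun j => by
      rw [Matrix.one_apply]; split_ifs <;> simp
    rw [hU, hU, hV, hV]
    by_cases hI : i ∈ I
    · rcases hε with rfl | rfl <;> simp [topRows, bottomRows, hI, h1] <;> ring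
    · rcases hε with rfl | rfl <;> simp [topRows, bottomRows, hI, h1]
  ext j l
  rw [← sub_eq_zero, Matrix.mul_apply, Matrix.mul_apply, ← Finset.sum_sub_distrib]
  simp only [Matrix.conjTranspose_apply, key, Finset.sum_sub_distrib]
  rw [sub_eq_zero]
  simp [Matrix.one_apply, hX.apply]

theorem IsSignedBasis.isHermitian (hX : X.IsHermitian) (h : IsSignedBasis X I U V)
    (hY : Y * U = V) (hU : U.det ≠ 0) : Y.IsHermitian := by
  have hunit : IsUnit U.det := isUnit_iff_ne_zero.2 hU
  have hunit' : IsUnit Uᴴ.det := by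
    rw [Matrix.det_conjTranspose]; exact isUnit_iff_ne_zero.2 (star_ne_zero.2 hU)
  have h₁ := h.conjTranspose_mul hX
  rw [← hY, Matrix.conjTranspose_mul] at h₁
  have h₂ : Uᴴ * (Y * U) * U⁻¹ = Uᴴ * Yᴴ * U * U⁻¹ := by rw [h₁]
  rw [Matrix.mul_assoc, Matrix.mul_nonsing_inv_cancel_right _ _ hunit,
    Matrix.mul_nonsing_inv_cancel_right _ _ hunit] at h₂
  have h₃ := congrArg (fun M => Uᴴ⁻¹ * M) h₂
  simp only [Matrix.nonsing_inv_mul_cancel_left _ _ hunit'] at h₃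
  exact h₃.symm

/-- Up to a power of i, the determinant is the characteristic polynomial of Y at -i. Each factor -i
- λ with λ real has modulus at least 1. -/
theorem one_le_norm_det_cayley (hY : Y.IsHermitian) : 1 ≤ ‖(1 - Complex.I • Y).det‖ := by
  have h₁ : (1 - Complex.I • Y) = Complex.I • (Matrix.scalar (Fin n) (-Complex.I) - Y) := by
    rw [smul_sub]
    congr 1
    ext i j
    simp [Matrix.scalar_apply, Matrix.diagonal_apply, Matrix.one_apply]
  rw [h₁, Matrix.det_smul, ← Matrix.eval_charpoly, hY.charpoly_eq, Polynomial.eval_prod, norm_mul,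
    norm_pow, Complex.norm_I, one_pow, one_mul, norm_prod]
  rw [← Finset.prod_const_one (s := (Finset.univ : Finset (Fin n)))]
  refine Finset.prod_le_prod (fun _ _ => zero_le_one) fun i _ => ?_
  have := Complex.abs_im_le_norm (-Complex.I - (hY.eigenvalues i : ℂ))
  simpa using this

theorem IsSignedBasis.norm_det_le (hX : X.IsHermitian) (h : IsSignedBasis X I U V)
    (hY : Y * U = V) (hU : U.det ≠ 0) : ‖U.det‖ ≤ ‖(1 - Complex.I • X).det‖ := by
  have hη : ∀ i, ∃ η : ℂ, ‖η‖ = 1 ∧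
      ∀ j, U i j - Complex.I * V i j = η * (1 - Complex.I • X) i j := by
    intro i
    obtain ⟨ε, hε, hU, hV⟩ := h i
    have hε1 : ‖ε‖ = 1 := by rcases hε with rfl | rfl <;> simp
    by_cases hI : i ∈ I
    -- For a swapped row, U - iV is ε(-X - i·1) = -iε(1 - iX).
    · refine ⟨-Complex.I * ε, by simp [hε1], fun j => ?_⟩
      simp only [hU, hV, topRows, bottomRows, hI, if_true, Matrix.of_apply, Matrix.sub_apply,
        Matrix.smul_apply, smul_eq_mul]
      linear_combination (-ε * X i j) * Complex.I_mul_I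
    · refine ⟨ε, hε1, fun j => ?_⟩
      simp only [hU, hV, topRows, bottomRows, hI, if_false, Matrix.of_apply, Matrix.sub_apply,
        Matrix.smul_apply, smul_eq_mul]
      ring
  choose η hη1 hη using hη
  have h₁ : (1 - Complex.I • Y) * U = Matrix.diagonal η * (1 - Complex.I • X) := by
    ext i j
    rw [Matrix.diagonal_mul, ← hη, Matrix.sub_mul, Matrix.one_mul, Matrix.smul_mul, hY]
    rfl
  have h₂ := congrArg (fun M : Mat n => ‖M.det‖) h₁
  simp only [Matrix.det_mul, Matrix.det_diagonal, norm_mul, norm_prod, hη1, Finset.prod_const_one,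
    one_mul] at h₂
  rw [← h₂]
  exact le_mul_of_one_le_left (norm_nonneg _)
    (one_le_norm_det_cayley (h.isHermitian hX hY hU))

end Bounds

/-! ### Correctness of the search -/

section Correctness

variable {n : ℕ}

theorem swapMatrix_mul {κ : Type} (k : Fin n) (M : Matrix (Fin n ⊕ Fin n) κ ℂ) :
    swapMatrix k * M = permRows {k} M := by
  obtain ⟨M₁, M₂, rfl⟩ : ∃ M₁ M₂, M = Matrix.fromRows M₁ M₂ :=
    ⟨M.toRows₁, M.toRows₂, M.fromRows_toRows.symm⟩
  rw [swapMatrix, Matrix.fromBlocks_mul_fromRows]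
  ext i j
  rcases i with i | i
  · by_cases hi : i = k
    · subst hi; simp [permRows, Matrix.sub_mul]
    · simp [permRows, Matrix.sub_mul, hi]
  · by_cases hi : i = k
    · subst hi; simp [permRows, Matrix.sub_mul]
    · simp [permRows, Matrix.sub_mul, hi]

theorem permMatrix_mul {κ : Type} (I : Finset (Fin n)) (M : Matrix (Fin n ⊕ Fin n) κ ℂ) :
    permMatrix I * M = permRows I M := by
  have key : ∀ l : List (Fin n), l.Nodup → (l.map swapMatrix).prod * M = permRows l.toFinset M := by
    intro l
    induction l with
    | nil =>
      intro _
      ext i j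
      rcases i with i | i <;> simp [permRows]
    | cons k l ih =>
      intro hl
      obtain ⟨hkl, hl⟩ := List.nodup_cons.1 hl
      rw [List.map_cons, List.prod_cons, Matrix.mul_assoc, ih hl, swapMatrix_mul]
      ext i j
      rcases i with i | i <;> by_cases hi : i = k <;> simp [permRows, hi, hkl]
  have := key ((List.finRange n).filter (· ∈ I)) ((List.nodup_finRange n).filter _)
  rw [permMatrix, this]
  congr 1
  ext i
  simp

/-- With T the upper block of P⁻¹[1; X], one has [1; Y] = P⁻¹[1; X]T⁻¹, so U₁ = T⁻¹ and U₂ = XT⁻¹.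
-/
theorem isBoundedBasis_of_mul_topRows {τ : ℝ} {X Y : Mat n} {I : Finset (Fin n)}
    (hdet : (topRows X I).det ≠ 0) (hY : Y * topRows X I = bottomRows X I)
    (hτ : ∀ i j, ‖Y i j‖ ≤ τ) : IsBoundedBasis τ X I := by
  have hunit : IsUnit (topRows X I).det := isUnit_iff_ne_zero.2 hdet
  refine ⟨Y, (topRows X I)⁻¹, X * (topRows X I)⁻¹, ?_, ?_, ?_, hτ⟩
  · have h₁ : Matrix.fromRows (1 : Mat n) Y
        = Matrix.fromRows (topRows X I) (bottomRows X I) * (topRows X I)⁻¹ := by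
      rw [Matrix.fromRows_mul, Matrix.mul_nonsing_inv _ hunit, ← hY,
        Matrix.mul_nonsing_inv_cancel_right _ _ hunit]
    have h₂ : permRows I (Matrix.fromRows (topRows X I) (bottomRows X I))
        = Matrix.fromRows (1 : Mat n) X := by
      ext i j
      rcases i with i | i <;> by_cases hi : i ∈ I <;> simp [permRows, topRows, bottomRows, hi]
    rw [h₁, ← Matrix.mul_assoc, permMatrix_mul, h₂, Matrix.fromRows_mul, Matrix.one_mul]
  · rw [Matrix.isUnit_iff_isUnit_det]
    exact Matrix.isUnit_nonsing_inv_det _ hunit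
  · rw [Matrix.nonsing_inv_nonsing_inv _ hunit, Matrix.nonsing_inv_mul_cancel_right _ _ hunit]

/-- Signs may be ignored during the search: conjugating Y by the diagonal matrix of row signs
restores the true basis without changing any modulus. -/
theorem IsSignedBasis.isBoundedBasis {τ : ℝ} {X U V Y : Mat n} {I : Finset (Fin n)}
    (h : IsSignedBasis X I U V) (hU : U.det ≠ 0) (hY : Y * U = V) (hτ : ∀ i j, ‖Y i j‖ ≤ τ) :
    IsBoundedBasis τ X I := by
  choose ε hε hUε hVε using h
  have hsq : ∀ i, ε i * ε i = 1 := fun i => by rcases hε i with h | h <;> simp [h]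
  have hn1 : ∀ i, ‖ε i‖ = 1 := fun i => by rcases hε i with h | h <;> simp [h]
  refine isBoundedBasis_of_mul_topRows (Y := Matrix.of fun i j => ε i * Y i j * ε j) ?_ ?_ ?_
  · have : U = Matrix.diagonal ε * topRows X I := by
      ext i j; rw [Matrix.diagonal_mul, hUε]
    rw [this, Matrix.det_mul] at hU
    exact right_ne_zero_of_mul hU
  · ext i l
    calc _ = ε i * ∑ j, Y i j * U j l := by
          rw [Matrix.mul_apply, Finset.mul_sum]
          refine Finset.sum_congr rfl fun j _ => ?_
          rw [hUε, Matrix.of_apply]; ring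
      _ = ε i * V i l := by rw [← Matrix.mul_apply, hY]
      _ = _ := by rw [hVε, ← mul_assoc, hsq, one_mul]
  · intro i j
    simpa [hn1] using hτ i j

theorem norm_le_of_principal_minors_le {τ : ℝ} (hτ : Real.sqrt 2 < τ) {Y : Mat n}
    (hY : Y.IsHermitian) (h₁ : ∀ k, ‖Y k k‖ ≤ pivotThreshold τ)
    (h₂ : ∀ a b, a < b → ‖Y a a * Y b b - Y a b * Y b a‖ ≤ pivotThreshold τ) (i j : Fin n) :
    ‖Y i j‖ ≤ τ := by
  have hγ := one_lt_pivotThreshold hτ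
  have hspec := pivotThreshold_spec τ
  have hτ0 : 0 < τ := by linarith [one_lt_of_sqrt_two_lt hτ]
  have herm : ∀ i j, ‖Y i j‖ = ‖Y j i‖ := fun i j => by rw [← hY.apply i j, norm_star]
  have main : ∀ a b, a < b → ‖Y a b‖ ≤ τ := fun a b hab => by
    refine le_of_sq_le_sq ?_ hτ0.le
    calc ‖Y a b‖ ^ 2 = ‖Y a a * Y b b - (Y a a * Y b b - Y a b * Y b a)‖ := by
          rw [sub_sub_cancel, norm_mul, ← herm a b, sq]
      _ ≤ ‖Y a a‖ * ‖Y b b‖ + ‖Y a a * Y b b - Y a b * Y b a‖ := by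
          rw [← norm_mul]; exact norm_sub_le _ _
      _ ≤ pivotThreshold τ * pivotThreshold τ + pivotThreshold τ := by
          gcongr
          · exact h₁ a
          · exact h₁ b
          · exact h₂ a b hab
      _ = τ ^ 2 := by rw [← hspec]; ring
  rcases lt_trichotomy i j with h | rfl | h
  · exact main i j h
  · refine (h₁ i).trans (le_of_sq_le_sq ?_ hτ0.le)
    nlinarith
  · rw [herm]; exact main j i h

/-- What is known about the state of the search after `t` rounds. -/
def SearchInvariant (τ : ℝ) (X : Mat n) (t : ℕ) (W : Finset (Fin n) × Mat n × Bool) : Prop :=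
  ∃ U V : Mat n, IsSignedBasis X W.1 U V ∧ U.det ≠ 0 ∧ W.2.1 * U = V ∧
    if W.2.2 then ∀ i j, ‖W.2.1 i j‖ ≤ τ
    else pivotThreshold τ ^ t * ‖(1 - Complex.I • X).det‖ ≤ 2 ^ n * ‖U.det‖

theorem SearchInvariant.pivot {τ : ℝ} (hτ : Real.sqrt 2 < τ) {X : Mat n} {t : ℕ}
    {I : Finset (Fin n)} {U V Y' : Mat n} (hS : IsSignedBasis X I U V) (hU : U.det ≠ 0)
    (hdet : pivotThreshold τ ^ t * ‖(1 - Complex.I • X).det‖ ≤ 2 ^ n * ‖U.det‖)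
    {K : Finset (Fin n)} {d : ℂ} (hd : pivotThreshold τ < ‖d‖)
    (hK : (swapTop K U V).det = d * U.det) (hY' : Y' * swapTop K U V = swapBottom K U V) :
    SearchInvariant τ X (t + 1) (symmDiff I K, Y', false) := by
  have hγ := one_lt_pivotThreshold hτ
  refine ⟨_, _, hS.swap K, ?_, hY', ?_⟩
  · rw [hK]
    refine mul_ne_zero (fun h0 => ?_) hU
    rw [h0, norm_zero] at hd
    linarith
  · rw [if_neg (by simp), hK, norm_mul, pow_succ]
    calc _ = pivotThreshold τ * (pivotThreshold τ ^ t * ‖(1 - Complex.I • X).det‖) := by ring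
      _ ≤ ‖d‖ * (2 ^ n * ‖U.det‖) := by gcongr
      _ = _ := by ring

theorem searchBasis_isBoundedBasis {τ : ℝ} (hτ : Real.sqrt 2 < τ) {X : Mat n}
    (hX : X.IsHermitian) : IsBoundedBasis τ X (searchBasis exactSystem τ X).val := by
  have hγ := one_lt_pivotThreshold hτ
  obtain ⟨hinv, hdet⟩ := startBasis_spec hX
  have hdet0 : (1 - Complex.I • X).det ≠ 0 := by
    rw [← partialCayley_univ]; exact det_partialCayley_ne_zero hX _
  have start : SearchInvariant τ X 0 ((startBasis exactSystem X).val.1,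
      bottomRows X (startBasis exactSystem X).val.1 * (startBasis exactSystem X).val.2, false) := by
    refine ⟨_, _, fun i => ⟨1, Or.inl rfl, fun j => (one_mul _).symm, fun j => (one_mul _).symm⟩,
      fun h0 => ?_, by rw [Matrix.mul_assoc, hinv, Matrix.mul_one], by simpa using hdet⟩
    have := congrArg Matrix.det hinv
    rw [Matrix.det_mul, h0, mul_zero, Matrix.det_one] at this
    exact zero_ne_one this
  have last : ∀ W, SearchInvariant τ X (maxPivots τ n) W → IsBoundedBasis τ X W.1 := by
    rintro ⟨I, Y, done⟩ ⟨U, V, hS, hU, hY, hW⟩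
    cases done
    -- If every round had pivoted, γ to the power `maxPivots τ n` would be at most 2ⁿ. The `+ 1`
    -- after the floor excludes this, so some round finds no pivot and sets the flag.
    · rw [if_neg (by simp)] at hW
      have h₁ : pivotThreshold τ ^ maxPivots τ n * ‖(1 - Complex.I • X).det‖
          ≤ 2 ^ n * ‖(1 - Complex.I • X).det‖ :=
        hW.trans (by gcongr; exact hS.norm_det_le hX hY hU)
      have h₂ := le_of_mul_le_mul_right h₁ (norm_pos_iff.2 hdet0)
      have h₃ := Real.log_le_log (by positivity) h₂
      rw [Real.log_pow, Real.log_pow, ← le_div_iff₀ (Real.log_pos hγ)] at h₃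
      have h₄ := Nat.lt_floor_add_one ((n : ℝ) * Real.log 2 / Real.log (pivotThreshold τ))
      rw [maxPivots, Nat.cast_add_one] at h₃
      exact absurd h₄ (not_lt.2 h₃)
    · exact hS.isBoundedBasis hU hY (by simpa using hW)
  simp only [searchBasis, Flop.val_bind, val_forEach, Flop.val_pure]
  have bot : (fun i j => if i ∈ (startBasis exactSystem X).val.1 then (if i = j then 1 else 0)
      else X i j : Mat n) = bottomRows X (startBasis exactSystem X).val.1 := by
    ext i j; simp [bottomRows, Matrix.one_apply]
  rw [bot, val_mmul]
  refine last _ (foldl_induction (P := SearchInvariant τ X) ?_ _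
    (by rw [Nat.zero_add, List.length_range]) start)
  rintro t ⟨I, Y, done⟩ _ ⟨U, V, hS, hU, hY, hW⟩
  cases done
  swap
  · exact ⟨U, V, hS, hU, hY, hW⟩
  rw [if_neg (by simp)] at hW
  dsimp only at hS hY
  simp only [Bool.false_eq_true, if_false, Flop.val_bind]
  generalize h₁ : (firstAbove _ _ (List.finRange n)).val = o₁
  rcases o₁ with _ | k
  · have hdiag := firstAbove_eq_none h₁
    simp only [Flop.val_bind]
    generalize h₂ : (firstAbove _ _ (List.filter _ _)).val = o₂
    rcases o₂ with _ | ⟨a, b⟩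
    · refine ⟨U, V, hS, hU, hY, ?_⟩
      have hpair := firstAbove_eq_none h₂
      simp only [Flop.val_pure, if_true]
      refine norm_le_of_principal_minors_le hτ (hS.isHermitian hX hY hU)
        (fun k => by simpa using hdiag k (List.mem_finRange k)) fun a b hab => ?_
      simpa [minorTwo] using hpair (a, b) (by simpa using hab)
    · obtain ⟨hmem, hlt⟩ := firstAbove_eq_some h₂
      have hab : a ≠ b := by
        have : a < b := by simpa using hmem
        exact this.ne
      have hlt : pivotThreshold τ < ‖Y a a * Y b b - Y a b * Y b a‖ := by simpa [minorTwo] using hlt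
      refine SearchInvariant.pivot hτ hS hU hW hlt (det_swapTop_pair hY hab)
        (pivotTwo_mul hY hab fun h0 => ?_)
      rw [h0, norm_zero] at hlt
      linarith
  · have hlt : pivotThreshold τ < ‖Y k k‖ := by simpa using (firstAbove_eq_some h₁).2
    refine SearchInvariant.pivot hτ hS hU hW (by rwa [norm_neg]) (det_swapTop_singleton hY k)
      (pivotOne_mul hY fun h0 => ?_)
    rw [h0, norm_zero] at hlt
    linarith

end Correctness

end Riccati

/-! ### The theorem: cost bounds and correctness of the basis search. -/

theorem theorem3 :
    -- the algorithm with the standard routines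
    (∀ τ₀ : ℝ, Real.sqrt 2 < τ₀ → ∃ C : ℝ, ∀ τ : ℝ, τ₀ ≤ τ →
      ∀ (F : Riccati.FloatSystem) (inner : Riccati.Inner) (kmax n : ℕ), 0 < n →
      ∀ A G Q : Matrix (Fin n) (Fin n) ℂ,
        let run := Riccati.permutedVerify F (Riccati.standardKit F τ) inner kmax A G Q
        (run.flops : ℝ) ≤ C * ((n : ℝ) ^ 3 * Real.logb τ n
          + (n : ℝ) ^ 3 * (max 1 run.val.steps : ℕ))) ∧
    -- the permutation found by the standard routine, in exact arithmetic
    (∀ τ : ℝ, Real.sqrt 2 < τ → ∀ (n : ℕ) (X : Matrix (Fin n) (Fin n) ℂ), X.IsHermitian →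
      Riccati.IsBoundedBasis τ X
        ((Riccati.standardKit Riccati.exactSystem τ).perm X).val) ∧
    -- the algorithm with any other routines of the same cost
    (∀ c : ℝ, ∃ C : ℝ, ∀ (τ : ℝ) (R : Riccati.Kit), Real.sqrt 2 < τ → R.Within c τ →
      ∀ (F : Riccati.FloatSystem) (inner : Riccati.Inner) (kmax n : ℕ), 0 < n →
      ∀ A G Q : Matrix (Fin n) (Fin n) ℂ,
        let run := Riccati.permutedVerify F R inner kmax A G Q
        (run.flops : ℝ) ≤ C * ((n : ℝ) ^ 3 * Real.logb τ n
          + (n : ℝ) ^ 3 * (max 1 run.val.steps : ℕ))) :=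
  -- The constant is 7⌈|c|⌉ + 3000, with c from `standardKit_within`, a function of τ₀ alone.
  ⟨fun _ h₀ => ⟨_, fun _ h F inner kmax _ hn A G Q =>
      Riccati.permutedVerify_flops_le (h₀.trans_le h) (Riccati.standardKit_within h₀ h F) F inner
        kmax hn A G Q⟩,
    fun _ hτ _ _ hX => Riccati.searchBasis_isBoundedBasis hτ hX,
    fun _ => ⟨_, fun _ _ hτ hR F inner kmax _ hn A G Q =>
      Riccati.permutedVerify_flops_le hτ hR F inner kmax hn A G Q⟩⟩
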